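/- Let $d\ge 2$ and let $(\mathfrak M,g)$ be a smooth compact connected Riemannian manifold without boundary, of dimension $d-1$, with volume measure $dv_g$ and Laplace–Beltrami operator $\Delta_g$. Let $\lambda_1^{\mathfrak M}$ be the lowest positive eigenvalue of $-\Delta_g$. Equip the cylinder $\mathcal C=\mathbb R\times\mathfrak M$ with the measure $d\nu=ds\,dv_g$, and let $\mathrm H^1(\mathcal C)$ be the completion of the space of smooth functions $u$ on $\mathcal C$ for which $$\|u\|_{\mathrm H^1}^2=\|u\|_{\mathrm L^2(\mathcal C)}^2+\|\partial_s u\|_{\mathrm L^2(\mathcal C)}^2+\|\nabla_g u\|_{\mathrm L^2(\mathcal C)}^2$$ is finite. Let $p>2$, with $p<\frac{2d}{d-2}$ if $d\ge 3$. For $\Lambda>0$ define $$\varphi_\Lambda(s)=\Big(\frac p2\,\Lambda\Big)^{\frac1{p-2}}\Big(\cosh\Big(\frac{p-2}2\,\sqrt\Lambda\,s\Big)\Big)^{-\frac2{p-2}},\qquad \mu_{\mathbb R}(\Lambda)=\frac{\|\varphi_\Lambda'\|_{\mathrm L^2(\mathbb R)}^2+\Lambda\,\|\varphi_\Lambda\|_{\mathrm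 L^2(\mathbb R)}^2}{\|\varphi_\Lambda\|_{\mathrm L^p(\mathbb R)}^2},\qquad \mu_\star(\Lambda)=\mathrm{vol}_g(\mathfrak M)^{1-\frac2p}\,\mu_{\mathbb R}(\Lambda),$$ and, for $u\in\mathrm H^1(\mathcal C)$, the Gagliardo–Nirenberg functional $$\mathcal G[u]=\|\partial_s u\|_{\mathrm L^2(\mathcal C)}^2+\|\nabla_g u\|_{\mathrm L^2(\mathcal C)}^2+\Lambda\,\|u\|_{\mathrm L^2(\mathcal C)}^2-\mu_\star(\Lambda)\,\|u\|_{\mathrm L^p(\mathcal C)}^2 .$$ If $$\Lambda>\frac{4\,\lambda_1^{\mathfrak M}}{p^2-4},$$ then $\varphi_\Lambda$, seen as a function $(s,\omega)\mapsto\varphi_\Lambda(s)$ on $\mathcal C$, belongs to $\mathrm H^1(\mathcal C)$ and is not a local minimizer of $\mathcal G$ on $\mathrm H^1(\mathcal C)$: for every $\delta>0$ there is $u\in\mathrm H^1(\mathcal C)$ with $\|u-\varphi_\Lambda\|_{\mathrm H^1}<\delta$ and $\mathcal G[u]<\mathcal G[\varphi_\Lambda]$. -/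

import Mathlib

open Bundle Manifold MeasureTheory Set
open scoped ContDiff

noncomputable section

namespace GNCylinder

section Manifold

variable {m : ℕ} {M : Type*} [TopologicalSpace M] [ChartedSpace (EuclideanSpace ℝ (Fin m)) M]
  [RiemannianBundle (fun x : M => TangentSpace (𝓡 m) x)]

/-- The coordinate vector field `∂ᵢ` of the chart `e`, at the point with coordinates `y`. -/
def coordVector (e : OpenPartialHomeomorph M (EuclideanSpace ℝ (Fin m)))
    (y : EuclideanSpace ℝ (Fin m)) (i : Fin m) : TangentSpace (𝓡 m) (e.symm y) :=
  mfderiv (𝓡 m) (𝓡 m) e.symm y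
    (EuclideanSpace.single i (1 : ℝ) : EuclideanSpace ℝ (Fin m))

/-- The coefficients `gᵢⱼ = g(∂ᵢ, ∂ⱼ)` of the metric in the chart `e`, at the coordinates `y`. -/
def metricMatrix (e : OpenPartialHomeomorph M (EuclideanSpace ℝ (Fin m)))
    (y : EuclideanSpace ℝ (Fin m)) : Matrix (Fin m) (Fin m) ℝ :=
  Matrix.of fun i j => inner ℝ (coordVector e y i) (coordVector e y j)

/-- The density `√(det gᵢⱼ)` of the Riemannian volume in the chart `e`. -/
def volumeDensity (e : OpenPartialHomeomorph M (EuclideanSpace ℝ (Fin m)))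
    (y : EuclideanSpace ℝ (Fin m)) : ℝ :=
  √(metricMatrix e y).det

/-- The Riemannian volume of the domain of the chart `e`: the image under `e⁻¹` of the measure
`√(det gᵢⱼ) dy` on the open set `e.target`. -/
def chartVolume [MeasurableSpace M]
    (e : OpenPartialHomeomorph M (EuclideanSpace ℝ (Fin m))) : Measure M :=
  ((volume.restrict e.target).withDensity fun y => ENNReal.ofReal (volumeDensity e y)).map e.symm

variable (m M) in
/-- The Riemannian volume measure `dv_g`. By the change of variables formula, the measures
`chartVolume e` are the restrictions of one measure to the domains of the charts, and this
measure is their supremum. -/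
def riemannianVolume [MeasurableSpace M] : Measure M :=
  ⨆ e ∈ atlas (EuclideanSpace ℝ (Fin m)) M, chartVolume e

/-- The Riemannian gradient `∇_g f` at `x`: the tangent vector with `g(∇_g f, v) = df(v)`. -/
def riemannianGradient (f : M → ℝ) (x : M) : TangentSpace (𝓡 m) x :=
  haveI : FiniteDimensional ℝ (TangentSpace (𝓡 m) x) :=
    inferInstanceAs (FiniteDimensional ℝ (EuclideanSpace ℝ (Fin m)))
  haveI : CompleteSpace (TangentSpace (𝓡 m) x) := FiniteDimensional.complete ℝ _
  (InnerProductSpace.toDual ℝ (TangentSpace (𝓡 m) x)).symm (mfderiv (𝓡 m) 𝓘(ℝ, ℝ) f x)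

/-- The Laplace-Beltrami operator in the chart `e`:
`(1 / √(det g)) ∑ᵢ ∂ᵢ (√(det g) ∑ⱼ gⁱʲ ∂ⱼ f)`, at the point with coordinates `y`. -/
def laplacianInChart (e : OpenPartialHomeomorph M (EuclideanSpace ℝ (Fin m))) (f : M → ℝ)
    (y : EuclideanSpace ℝ (Fin m)) : ℝ :=
  (volumeDensity e y)⁻¹ * ∑ i, fderiv ℝ
    (fun z => volumeDensity e z * ∑ j, (metricMatrix e z)⁻¹ i j *
      fderiv ℝ (f ∘ e.symm) z (EuclideanSpace.single j (1 : ℝ)))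
    y (EuclideanSpace.single i (1 : ℝ))

variable (m M) in
/-- `lam` is an eigenvalue of `-Δ_g` on `M`: there is a smooth function `f`, not identically zero,
with `-Δ_g f = lam f` on `M` (expressed in each chart of the atlas). -/
def IsLaplaceEigenvalue (lam : ℝ) : Prop :=
  ∃ f : M → ℝ, ContMDiff (𝓡 m) 𝓘(ℝ, ℝ) ∞ f ∧ f ≠ 0 ∧
    ∀ e ∈ atlas (EuclideanSpace ℝ (Fin m)) M, ∀ y ∈ e.target,
      -laplacianInChart e f y = lam * f (e.symm y)

variable (m M) in
/-- `lam` is the lowest positive eigenvalue of `-Δ_g` on `M`. -/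
def IsFirstPositiveEigenvalue (lam : ℝ) : Prop :=
  IsLeast {t : ℝ | 0 < t ∧ IsLaplaceEigenvalue m M t} lam

variable (m M) in
/-- The measure `dν = ds dv_g` on the cylinder `ℝ × M`. -/
def cylinderMeasure [MeasurableSpace M] : Measure (ℝ × M) :=
  (volume : Measure ℝ).prod (riemannianVolume m M)

variable (m M) in
/-- A function `u` on the cylinder together with candidates for its derivative `∂ₛ u` and for its
gradient `∇_g u` along `M`. -/
structure Jet where
  val : ℝ × M → ℝ
  ds : ℝ × M → ℝ
  grad : ∀ q : ℝ × M, TangentSpace (𝓡 m) q.2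

/-- The difference of two jets. -/
def Jet.sub (w w' : Jet m M) : Jet m M where
  val q := w.val q - w'.val q
  ds q := w.ds q - w'.ds q
  grad q := w.grad q - w'.grad q

variable (m) in
/-- The function `f` with its classical derivatives `∂ₛ f` and `∇_g f`. -/
def classicalJet (f : ℝ × M → ℝ) : Jet m M where
  val := f
  ds q := deriv (fun s => f (s, q.2)) q.1
  grad q := riemannianGradient (fun x => f (q.1, x)) q.2

/-- The norm `(‖u‖₂² + ‖∂ₛ u‖₂² + ‖∇_g u‖₂²)^(1/2)` of `H¹(ℝ × M)`. -/
def h1Norm [MeasurableSpace M] (w : Jet m M) : ENNReal :=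
  (∫⁻ q, (‖w.val q‖ₑ ^ 2 + ‖w.ds q‖ₑ ^ 2 + ‖w.grad q‖ₑ ^ 2) ∂(cylinderMeasure m M)) ^ (1 / 2 : ℝ)

/-- Membership in the Sobolev space `H¹(ℝ × M)`, the completion, for the `H¹` norm, of the space of
smooth functions with finite `H¹` norm: `w` consists of a measurable function, a
measurable function and a measurable field of vectors tangent to `M`, and is a limit in the `H¹`
norm of smooth functions of finite norm with their classical derivatives. (A field of vectors is
measurable when its action on each smooth function on `M` is.) -/
structure MemH1 [MeasurableSpace M] (w : Jet m M) : Prop where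
  aemeasurable_val : AEMeasurable w.val (cylinderMeasure m M)
  aemeasurable_ds : AEMeasurable w.ds (cylinderMeasure m M)
  aemeasurable_grad : ∀ h : M → ℝ, ContMDiff (𝓡 m) 𝓘(ℝ, ℝ) ∞ h →
    AEMeasurable (fun q : ℝ × M => (mfderiv (𝓡 m) 𝓘(ℝ, ℝ) h q.2 (w.grad q) : ℝ))
      (cylinderMeasure m M)
  approx : ∀ ε : ENNReal, 0 < ε → ∃ f : ℝ × M → ℝ,
    ContMDiff (𝓘(ℝ, ℝ).prod (𝓡 m)) 𝓘(ℝ, ℝ) ∞ f ∧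
      h1Norm (classicalJet m f) < ⊤ ∧ h1Norm (w.sub (classicalJet m f)) < ε

/-- `w₀` is a local minimizer on `H¹(ℝ × M)` of the functional `F`. -/
def IsLocalMinimizer [MeasurableSpace M] (F : Jet m M → ℝ) (w₀ : Jet m M) : Prop :=
  MemH1 w₀ ∧ ∃ δ : ENNReal, 0 < δ ∧
    ∀ w : Jet m M, MemH1 w → h1Norm (w.sub w₀) < δ → F w₀ ≤ F w

end Manifold

/-- `φ_Λ(s) = β (cosh (α s))^(-2/(p-2))`, `α = (p-2)/2 √Λ`, `β = (p Λ / 2)^(1/(p-2))`. -/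
def phiLam (p Lam : ℝ) (s : ℝ) : ℝ :=
  (p / 2 * Lam) ^ (1 / (p - 2)) * Real.cosh ((p - 2) / 2 * √Lam * s) ^ (-(2 / (p - 2)))

/-- `μ_ℝ(Λ) = (‖φ_Λ'‖₂² + Λ ‖φ_Λ‖₂²) / ‖φ_Λ‖_p²`, with norms on `ℝ`. -/
def muLine (p Lam : ℝ) : ℝ :=
  ((∫ s, deriv (phiLam p Lam) s ^ 2) + Lam * ∫ s, phiLam p Lam s ^ 2) /
    (∫ s, |phiLam p Lam s| ^ p) ^ (2 / p)

section Functional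

variable (m : ℕ) (M : Type*) [TopologicalSpace M] [ChartedSpace (EuclideanSpace ℝ (Fin m)) M]
  [RiemannianBundle (fun x : M => TangentSpace (𝓡 m) x)] [MeasurableSpace M]

/-- `μ⋆(Λ) = vol_g(M)^(1-2/p) μ_ℝ(Λ)`. -/
def muStar (p Lam : ℝ) : ℝ :=
  (riemannianVolume m M).real univ ^ (1 - 2 / p) * muLine p Lam

/-- The Gagliardo-Nirenberg functional
`G[u] = ‖∂ₛ u‖₂² + ‖∇_g u‖₂² + Λ ‖u‖₂² - μ⋆(Λ) ‖u‖_p²`. -/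
def gnFunctional (p Lam : ℝ) (w : Jet m M) : ℝ :=
  (∫ q, w.ds q ^ 2 ∂(cylinderMeasure m M)) + (∫ q, ‖w.grad q‖ ^ 2 ∂(cylinderMeasure m M))
    + Lam * (∫ q, w.val q ^ 2 ∂(cylinderMeasure m M))
    - muStar m M p Lam * (∫ q, |w.val q| ^ p ∂(cylinderMeasure m M)) ^ (2 / p)

/-- `φ_Λ`, seen as a function on the cylinder, with its derivatives. -/
def symmetricJet (p Lam : ℝ) : Jet m M :=
  classicalJet m fun q : ℝ × M => phiLam p Lam q.1

end Functional

end GNCylinder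

end

/-!
The symmetric function `φ` is perturbed in the direction `φ^(p/2)(s) f(ω)`, where `f` is an
eigenfunction of `-Δ_g` for the eigenvalue `λ₁`. Among the
directions with zero mean over the manifold, this is where the second variation of the functional
at `φ` is smallest relative to the `L²` norm: `φ^(p/2)` is the ground state of the linearized
operator `-∂ₛ² + Λ - (p - 1) φ^(p-2)`, with eigenvalue `-Λ (p² - 4) / 4`
(`integral_sq_deriv_phiLam_rpow_add`), and `f` adds `λ₁` (`gnFunctional_perturbedJet`). The sum
`λ₁ - Λ (p² - 4) / 4` is negative exactly under the hypothesis on `Λ`.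

Since `f` has mean zero, the quadratic terms of the functional split without cross terms. The
`L^p` norm is controlled from below by pointwise second order Taylor expansion
(`eventually_le_integral_abs_rpow`), which is uniform because the perturbation is `φ` times the
bounded function `φ^(p/2-1) f`. As `∫ φ'² + Λ ∫ φ² = ∫ φ^p`
(`integral_sq_deriv_phiLam_add`), the functional vanishes at `φ` and is negative at
`φ + ε φ^(p/2) f` for small `ε > 0` (`eventually_gnFunctional_perturbedJet_lt`). The integrals of
`φ` all follow from one virial identity, because the logarithmic derivative of `φ` is a multiple of
a hyperbolic tangent.

What is used of the manifold is the weak form `∫ g(∇f, ∇h) = λ₁ ∫ f h` of the eigenvalue equation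
(`integral_gradPairing`): `h = 1` shows that `f` has mean zero and `h = f` computes its Dirichlet
integral. It is obtained from a partition of unity and integration by parts in charts, once the
Riemannian volume is known to restrict to `√(det g) dy` in every chart
(`riemannianVolume_restrict_source`).
-/

noncomputable section

namespace GNCylinder

/-! ### The metric in a chart -/

section Charts

variable {m : ℕ} {M : Type*} [TopologicalSpace M] [ChartedSpace (EuclideanSpace ℝ (Fin m)) M]

local notation "𝔼" => EuclideanSpace ℝ (Fin m)

theorem contMDiffOn_coordVector [IsManifold (𝓡 m) ∞ M] {e : OpenPartialHomeomorph M 𝔼}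
    (he : e ∈ atlas 𝔼 M) (i : Fin m) :
    ContMDiffOn 𝓘(ℝ, 𝔼) (𝓡 m).tangent ∞
      (fun y => (⟨e.symm y, coordVector e y i⟩ : TangentBundle (𝓡 m) M)) e.target := by
  have h1 : ContMDiffOn 𝓘(ℝ, 𝔼) (𝓡 m) ∞ e.symm e.target :=
    contMDiffOn_symm_of_mem_maximalAtlas (IsManifold.subset_maximalAtlas he)
  have h2 := h1.contMDiffOn_tangentMapWithin (m := ∞) le_rfl e.open_target.uniqueMDiffOn
  have h3 : ContMDiff 𝓘(ℝ, 𝔼) (𝓡 m).tangent ∞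
      (fun y => (⟨y, (EuclideanSpace.single i (1 : ℝ) : 𝔼)⟩ : TangentBundle (𝓡 m) 𝔼)) := by
    intro y
    rw [contMDiffAt_totalSpace]
    refine ⟨contMDiffAt_id, ?_⟩
    simpa using contMDiffAt_const
  have h4 := h2.comp (h3.contMDiffOn (s := e.target)) (fun y hy => hy)
  refine h4.congr fun y hy => ?_
  simp only [Function.comp, tangentMapWithin, coordVector]
  rw [mfderivWithin_of_isOpen e.open_target hy]

theorem mdifferentiableAt_symm [IsManifold (𝓡 m) ∞ M] {e : OpenPartialHomeomorph M 𝔼}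
    (he : e ∈ atlas 𝔼 M) {y : 𝔼} (hy : y ∈ e.target) : MDifferentiableAt (𝓡 m) (𝓡 m) e.symm y :=
  mdifferentiableAt_atlas_symm (I := 𝓡 m) he hy

theorem fderiv_comp_symm [IsManifold (𝓡 m) ∞ M] {e : OpenPartialHomeomorph M 𝔼}
    (he : e ∈ atlas 𝔼 M) {y : 𝔼} (hy : y ∈ e.target) {f : M → ℝ}
    (hf : MDifferentiableAt (𝓡 m) 𝓘(ℝ, ℝ) f (e.symm y)) (i : Fin m) :
    fderiv ℝ (f ∘ e.symm) y (EuclideanSpace.single i (1 : ℝ)) =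
      mfderiv (𝓡 m) 𝓘(ℝ, ℝ) f (e.symm y) (coordVector e y i) := by
  have := mfderiv_comp y hf (mdifferentiableAt_symm he hy)
  rw [← mfderiv_eq_fderiv, this]
  rfl

theorem sum_coordVector (e : OpenPartialHomeomorph M 𝔼) (y : 𝔼) (v : 𝔼) :
    mfderiv (𝓡 m) (𝓡 m) e.symm y v = ∑ i, v i • coordVector e y i := by
  have h : v = ∑ i, v i • (EuclideanSpace.single i (1 : ℝ) : 𝔼) := by
    ext j; simp [Pi.single_apply, EuclideanSpace.single]
  conv_lhs => rw [h]
  exact (map_sum (mfderiv (𝓡 m) (𝓡 m) e.symm y) _ _).trans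
    (Finset.sum_congr rfl fun i _ => map_smul (mfderiv (𝓡 m) (𝓡 m) e.symm y) _ _)

/-- The coordinate vector fields of two charts differ by the Jacobian matrix of the transition map.
Both sides live in tangent spaces at propositionally equal points, hence the ascriptions to the
model space. -/
theorem coordVector_transition [IsManifold (𝓡 m) ∞ M] {e e' : OpenPartialHomeomorph M 𝔼}
    (he : e ∈ atlas 𝔼 M) (he' : e' ∈ atlas 𝔼 M) {y : 𝔼} (hy : y ∈ (e.symm.trans e').source)
    (i : Fin m) :
    (coordVector e y i : 𝔼) = 
      ∑ k, (fderiv ℝ (e.symm.trans e') y (EuclideanSpace.single i (1 : ℝ)) : 𝔼) k •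
        (coordVector e' (e' (e.symm y)) k : 𝔼) := by
  have hy1 : y ∈ e.target := hy.1
  have hy2 : e.symm y ∈ e'.source := hy.2
  have hτ : MDifferentiableAt (𝓡 m) (𝓡 m) (e.symm.trans e') y :=
    (mdifferentiableAt_atlas (I := 𝓡 m) he' hy2).comp y (mdifferentiableAt_symm he hy1)
  have hev : e.symm =ᶠ[nhds y] e'.symm ∘ (e.symm.trans e') := by
    filter_upwards [(e.symm.trans e').open_source.mem_nhds hy] with z hz
    exact (e'.left_inv hz.2).symm
  have h1 := mfderiv_comp y (mdifferentiableAt_symm he' (e'.map_source hy2)) hτ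
  have h2 : (mfderiv (𝓡 m) (𝓡 m) e.symm y : 𝔼 →L[ℝ] 𝔼) =
      mfderiv (𝓡 m) (𝓡 m) (e'.symm ∘ (e.symm.trans e')) y := hev.mfderiv_eq
  have h3 : (coordVector e y i : 𝔼) = (mfderiv (𝓡 m) (𝓡 m) e'.symm (e' (e.symm y)) : 𝔼 →L[ℝ] 𝔼)
      (mfderiv (𝓡 m) (𝓡 m) (e.symm.trans e') y (EuclideanSpace.single i (1 : ℝ) : 𝔼)) := by
    change (mfderiv (𝓡 m) (𝓡 m) e.symm y : 𝔼 →L[ℝ] 𝔼) _ = _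
    rw [h2, h1]
    rfl
  rw [h3, mfderiv_eq_fderiv]
  exact sum_coordVector e' _ _

theorem coordVector_linearIndependent [IsManifold (𝓡 m) ∞ M] {e : OpenPartialHomeomorph M 𝔼}
    (he : e ∈ atlas 𝔼 M) {y : 𝔼} (hy : y ∈ e.target) :
    LinearIndependent ℝ (coordVector e y) := by
  have hmd : e.MDifferentiable (𝓡 m) (𝓡 m) := mdifferentiable_of_mem_atlas he
  have hinj : Function.Injective (mfderiv (𝓡 m) (𝓡 m) e.symm y) :=
    Function.LeftInverse.injective (g := mfderiv (𝓡 m) (𝓡 m) e (e.symm y)) fun v =>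
      congrArg (fun L => L v) (hmd.comp_symm_deriv hy)
  rw [Fintype.linearIndependent_iff]
  intro g hg i
  have h := sum_coordVector e y (WithLp.toLp 2 g)
  have h0 : (WithLp.toLp 2 g : 𝔼) = 0 :=
    hinj ((h.trans hg).trans (map_zero (mfderiv (𝓡 m) (𝓡 m) e.symm y)).symm)
  exact congrArg (fun v : 𝔼 => v i) h0

variable [RiemannianBundle (fun x : M => TangentSpace (𝓡 m) x)]

theorem contDiffOn_metricMatrix [IsManifold (𝓡 m) ∞ M]
    [IsContMDiffRiemannianBundle (𝓡 m) ∞ 𝔼 (fun x : M => TangentSpace (𝓡 m) x)]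
    {e : OpenPartialHomeomorph M 𝔼} (he : e ∈ atlas 𝔼 M) (i j : Fin m) :
    ContDiffOn ℝ ∞ (fun y => metricMatrix e y i j) e.target := by
  rw [← contMDiffOn_iff_contDiffOn]
  exact ContMDiffOn.inner_bundle (contMDiffOn_coordVector he i) (contMDiffOn_coordVector he j)

theorem metricMatrix_posDef [IsManifold (𝓡 m) ∞ M] {e : OpenPartialHomeomorph M 𝔼}
    (he : e ∈ atlas 𝔼 M) {y : 𝔼} (hy : y ∈ e.target) : (metricMatrix e y).PosDef :=
  Matrix.posDef_gram_of_linearIndependent (coordVector_linearIndependent he hy)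

theorem volumeDensity_pos [IsManifold (𝓡 m) ∞ M] {e : OpenPartialHomeomorph M 𝔼}
    (he : e ∈ atlas 𝔼 M) {y : 𝔼} (hy : y ∈ e.target) : 0 < volumeDensity e y :=
  Real.sqrt_pos.2 (metricMatrix_posDef he hy).det_pos

theorem contDiffOn_det_metricMatrix [IsManifold (𝓡 m) ∞ M]
    [IsContMDiffRiemannianBundle (𝓡 m) ∞ 𝔼 (fun x : M => TangentSpace (𝓡 m) x)]
    {e : OpenPartialHomeomorph M 𝔼} (he : e ∈ atlas 𝔼 M) :
    ContDiffOn ℝ ∞ (fun y => (metricMatrix e y).det) e.target := by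
  simp only [Matrix.det_apply]
  refine ContDiffOn.sum fun σ _ => ContDiffOn.const_smul _ ?_
  exact contDiffOn_prod fun i _ => contDiffOn_metricMatrix he _ _

theorem contDiffOn_volumeDensity [IsManifold (𝓡 m) ∞ M]
    [IsContMDiffRiemannianBundle (𝓡 m) ∞ 𝔼 (fun x : M => TangentSpace (𝓡 m) x)]
    {e : OpenPartialHomeomorph M 𝔼} (he : e ∈ atlas 𝔼 M) :
    ContDiffOn ℝ ∞ (volumeDensity e) e.target :=
  (contDiffOn_det_metricMatrix he).sqrt fun _ hy => (metricMatrix_posDef he hy).det_pos.ne'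

theorem contDiffOn_metricMatrix_inv [IsManifold (𝓡 m) ∞ M]
    [IsContMDiffRiemannianBundle (𝓡 m) ∞ 𝔼 (fun x : M => TangentSpace (𝓡 m) x)]
    {e : OpenPartialHomeomorph M 𝔼} (he : e ∈ atlas 𝔼 M) (i j : Fin m) :
    ContDiffOn ℝ ∞ (fun y => (metricMatrix e y)⁻¹ i j) e.target := by
  simp only [Matrix.inv_def, Matrix.smul_apply, Ring.inverse_eq_inv', smul_eq_mul,
    Matrix.adjugate_apply]
  refine ((contDiffOn_det_metricMatrix he).inv
    fun y hy => (metricMatrix_posDef he hy).det_pos.ne').mul ?_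
  simp only [Matrix.det_apply]
  refine ContDiffOn.sum fun σ _ => ContDiffOn.const_smul _ ?_
  refine contDiffOn_prod fun k _ => ?_
  by_cases hk : σ k = j
  · simp only [Matrix.updateRow_apply, hk, if_true]
    exact contDiffOn_const
  · simp only [Matrix.updateRow_apply, hk, if_false]
    exact contDiffOn_metricMatrix he _ _

/-- The matrix of an endomorphism of Euclidean space in the standard basis. -/
def jacobianMatrix (L : 𝔼 →L[ℝ] 𝔼) : Matrix (Fin m) (Fin m) ℝ :=
  LinearMap.toMatrix (EuclideanSpace.basisFun (Fin m) ℝ).toBasis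
    (EuclideanSpace.basisFun (Fin m) ℝ).toBasis L.toLinearMap

theorem inner_riemannianGradient (f : M → ℝ) (x : M) (v : TangentSpace (𝓡 m) x) :
    inner ℝ (riemannianGradient f x) v = mfderiv (𝓡 m) 𝓘(ℝ, ℝ) f x v := by
  simp only [riemannianGradient]
  have : FiniteDimensional ℝ (TangentSpace (𝓡 m) x) := inferInstanceAs (FiniteDimensional ℝ 𝔼)
  have : CompleteSpace (TangentSpace (𝓡 m) x) := FiniteDimensional.complete ℝ _
  exact InnerProductSpace.toDual_symm_apply

theorem mfderiv_riemannianGradient [IsManifold (𝓡 m) ∞ M] {e : OpenPartialHomeomorph M 𝔼}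
    (he : e ∈ atlas 𝔼 M) {y : 𝔼} (hy : y ∈ e.target) {f h : M → ℝ}
    (hf : MDifferentiableAt (𝓡 m) 𝓘(ℝ, ℝ) f (e.symm y))
    (hh : MDifferentiableAt (𝓡 m) 𝓘(ℝ, ℝ) h (e.symm y)) :
    (mfderiv (𝓡 m) 𝓘(ℝ, ℝ) h (e.symm y) (riemannianGradient f (e.symm y)) : ℝ) =
      ∑ i, (∑ j, (metricMatrix e y)⁻¹ i j *
        fderiv ℝ (f ∘ e.symm) y (EuclideanSpace.single j (1 : ℝ))) *
        fderiv ℝ (h ∘ e.symm) y (EuclideanSpace.single i (1 : ℝ)) := by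
  have : FiniteDimensional ℝ (TangentSpace (𝓡 m) (e.symm y)) :=
    inferInstanceAs (FiniteDimensional ℝ 𝔼)
  have hcard : Fintype.card (Fin m) = Module.finrank ℝ (TangentSpace (𝓡 m) (e.symm y)) := by
    change _ = Module.finrank ℝ 𝔼
    simp
  set b := basisOfLinearIndependentOfCardEqFinrank' _ (coordVector_linearIndependent he hy) hcard
    with hb
  set a := b.repr (riemannianGradient f (e.symm y)) with ha
  have hbi : ∀ i, b i = coordVector e y i := fun i => by simp [hb]
  have hsum : riemannianGradient f (e.symm y) = ∑ i, a i • coordVector e y i := by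
    rw [← b.sum_repr (riemannianGradient f (e.symm y))]
    exact Finset.sum_congr rfl fun i _ => by rw [hbi]
  have hfj : ∀ j, fderiv ℝ (f ∘ e.symm) y (EuclideanSpace.single j (1 : ℝ)) =
      (metricMatrix e y).mulVec a j := fun j => by
    rw [fderiv_comp_symm he hy hf, ← inner_riemannianGradient, hsum, sum_inner]
    refine Finset.sum_congr rfl fun i _ => ?_
    rw [real_inner_smul_left, real_inner_comm, mul_comm]
    rfl
  have hdet : IsUnit (metricMatrix e y).det :=
    (metricMatrix_posDef he hy).det_pos.ne'.isUnit
  have hai : ∀ i, ∑ j, (metricMatrix e y)⁻¹ i j *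
      fderiv ℝ (f ∘ e.symm) y (EuclideanSpace.single j (1 : ℝ)) = a i := fun i => by
    simp only [hfj]
    change (metricMatrix e y)⁻¹.mulVec ((metricMatrix e y).mulVec a) i = a i
    rw [Matrix.mulVec_mulVec, Matrix.nonsing_inv_mul _ hdet, Matrix.one_mulVec]
  simp only [hai]
  rw [hsum]
  refine (map_sum (mfderiv (𝓡 m) 𝓘(ℝ, ℝ) h (e.symm y)) _ _).trans ?_
  refine Finset.sum_congr rfl fun i _ => ?_
  rw [fderiv_comp_symm he hy hh]
  exact map_smul (mfderiv (𝓡 m) 𝓘(ℝ, ℝ) h (e.symm y)) _ _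

/-- The metric at `x` as a function of two vectors of the model space, to which the tangent space at
`x` is definitionally equal. It serves to compare tangent vectors at propositionally equal
base points. -/
def metricForm (x : M) (v w : 𝔼) : ℝ :=
  Inner.inner (E := TangentSpace (𝓡 m) x) ℝ v w

theorem metricForm_sum_left {ι : Type*} (x : M) (t : Finset ι) (a : ι → ℝ) (c : ι → 𝔼) (w : 𝔼) :
    metricForm x (∑ k ∈ t, a k • c k) w = ∑ k ∈ t, a k * metricForm x (c k) w := by
  classical
  induction t using Finset.induction_on with
  | empty =>
    rw [Finset.sum_empty, Finset.sum_empty]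
    exact inner_zero_left (𝕜 := ℝ) (E := TangentSpace (𝓡 m) x) w
  | insert k t hk ih =>
    rw [Finset.sum_insert hk, Finset.sum_insert hk, ← ih]
    exact (inner_add_left (𝕜 := ℝ) (E := TangentSpace (𝓡 m) x) _ _ _).trans
      (congrArg (· + _) (real_inner_smul_left (F := TangentSpace (𝓡 m) x) _ _ _))

theorem metricForm_comm (x : M) (v w : 𝔼) : metricForm x v w = metricForm x w v :=
  real_inner_comm (F := TangentSpace (𝓡 m) x) _ _

theorem metricForm_sum_sum (x : M) (a b : Fin m → ℝ) (c : Fin m → 𝔼) :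
    metricForm x (∑ k, a k • c k) (∑ k, b k • c k) =
      ∑ k, (∑ l, a l * metricForm x (c l) (c k)) * b k := by
  rw [metricForm_comm, metricForm_sum_left]
  refine Finset.sum_congr rfl fun k _ => ?_
  rw [metricForm_comm, metricForm_sum_left, mul_comm]

theorem metricMatrix_transition [IsManifold (𝓡 m) ∞ M] {e e' : OpenPartialHomeomorph M 𝔼}
    (he : e ∈ atlas 𝔼 M) (he' : e' ∈ atlas 𝔼 M) {y : 𝔼} (hy : y ∈ (e.symm.trans e').source) :
    metricMatrix e y =
      (jacobianMatrix (fderiv ℝ (e.symm.trans e') y)).transpose *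
        metricMatrix e' ((e.symm.trans e') y) *
        jacobianMatrix (fderiv ℝ (e.symm.trans e') y) := by
  ext i j
  have hx : e'.symm (e' (e.symm y)) = e.symm y := e'.left_inv hy.2
  have h := metricForm_sum_sum (e.symm y)
    (fun k => (fderiv ℝ (e.symm.trans e') y (EuclideanSpace.single i (1 : ℝ)) : 𝔼) k)
    (fun k => (fderiv ℝ (e.symm.trans e') y (EuclideanSpace.single j (1 : ℝ)) : 𝔼) k)
    (fun k => (coordVector e' (e' (e.symm y)) k : 𝔼))
  have hci := coordVector_transition he he' hy i
  have hcj := coordVector_transition he he' hy j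
  have hm : ∀ l k, metricForm (e.symm y) (coordVector e' (e' (e.symm y)) l)
      (coordVector e' (e' (e.symm y)) k) = metricMatrix e' ((e.symm.trans e') y) l k := by
    intro l k
    exact (congrArg (fun x => metricForm x (coordVector e' (e' (e.symm y)) l)
      (coordVector e' (e' (e.symm y)) k)) hx).symm
  simp only [hm] at h
  refine (congrArg₂ (metricForm (e.symm y)) hci hcj).trans (h.trans ?_)
  simp only [Matrix.mul_apply, Matrix.transpose_apply, jacobianMatrix, LinearMap.toMatrix_apply]
  simp only [OrthonormalBasis.coe_toBasis, EuclideanSpace.basisFun_apply,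
    OrthonormalBasis.coe_toBasis_repr_apply, EuclideanSpace.basisFun_repr]
  rfl

theorem volumeDensity_transition [IsManifold (𝓡 m) ∞ M] {e e' : OpenPartialHomeomorph M 𝔼}
    (he : e ∈ atlas 𝔼 M) (he' : e' ∈ atlas 𝔼 M) {y : 𝔼} (hy : y ∈ (e.symm.trans e').source) :
    volumeDensity e y = |(fderiv ℝ (e.symm.trans e') y).det| *
      volumeDensity e' ((e.symm.trans e') y) := by
  have hdet : (jacobianMatrix (fderiv ℝ (e.symm.trans e') y)).det =
      (fderiv ℝ (e.symm.trans e') y).det := LinearMap.det_toMatrix _ _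
  rw [volumeDensity, metricMatrix_transition he he' hy, Matrix.det_mul, Matrix.det_mul,
    Matrix.det_transpose, hdet, mul_right_comm, Real.sqrt_mul (mul_self_nonneg _),
    Real.sqrt_mul_self_eq_abs]
  rfl

end Charts

/-! ### The Riemannian volume -/

section Volume

variable {m : ℕ} {M : Type*} [TopologicalSpace M] [ChartedSpace (EuclideanSpace ℝ (Fin m)) M]

local notation "𝔼" => EuclideanSpace ℝ (Fin m)

theorem aemeasurable_symm {M : Type*} [TopologicalSpace M] [MeasurableSpace M] [BorelSpace M]
    (e : OpenPartialHomeomorph M 𝔼) :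
    AEMeasurable e.symm (volume.restrict e.target) :=
  e.continuousOn_symm.aemeasurable e.open_target.measurableSet

variable (m M) in
theorem exists_countable_atlas_cover [SigmaCompactSpace M] [Nonempty M] :
    ∃ c : ℕ → OpenPartialHomeomorph M 𝔼, (∀ n, c n ∈ atlas 𝔼 M) ∧ ⋃ n, (c n).source = univ := by
  obtain ⟨s, hs, hcov⟩ := countable_cover_nhds_of_sigmaCompact
    fun x : M => (chartAt 𝔼 x).open_source.mem_nhds (mem_chart_source 𝔼 x)
  have hne : s.Nonempty := by
    by_contra h
    rw [not_nonempty_iff_eq_empty] at h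
    simp only [h, mem_empty_iff_false, iUnion_of_empty, iUnion_empty] at hcov
    exact empty_ne_univ hcov
  obtain ⟨f, rfl⟩ := hs.exists_eq_range hne
  refine ⟨fun n => chartAt 𝔼 (f n), fun n => chart_mem_atlas _ _, ?_⟩
  rw [← hcov, biUnion_range]

variable [RiemannianBundle (fun x : M => TangentSpace (𝓡 m) x)] [IsManifold (𝓡 m) ∞ M]
  [IsContMDiffRiemannianBundle (𝓡 m) ∞ (EuclideanSpace ℝ (Fin m))
    (fun x : M => TangentSpace (𝓡 m) x)] {e e' : OpenPartialHomeomorph M (EuclideanSpace ℝ (Fin m))}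

theorem aemeasurable_volumeDensity (he : e ∈ atlas 𝔼 M) :
    AEMeasurable (volumeDensity e) (volume.restrict e.target) :=
  (contDiffOn_volumeDensity he).continuousOn.aemeasurable e.open_target.measurableSet

variable [MeasurableSpace M] [BorelSpace M]

theorem lintegral_chartVolume (he : e ∈ atlas 𝔼 M) {G : M → ENNReal} (hG : Measurable G) :
    ∫⁻ x, G x ∂(chartVolume e) =
      ∫⁻ y in e.target, ENNReal.ofReal (volumeDensity e y) * G (e.symm y) := by
  have hs : AEMeasurable e.symm ((volume.restrict e.target).withDensity
      fun y => ENNReal.ofReal (volumeDensity e y)) :=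
    (aemeasurable_symm e).mono_ac (withDensity_absolutelyContinuous _ _)
  rw [chartVolume, lintegral_map' hG.aemeasurable hs,
    lintegral_withDensity_eq_lintegral_mul₀ (aemeasurable_volumeDensity he).ennreal_ofReal
      (g := fun y => G (e.symm y)) (hG.comp_aemeasurable (aemeasurable_symm e))]
  rfl

theorem integral_chartVolume (he : e ∈ atlas 𝔼 M) {G : M → ℝ}
    (hG : AEStronglyMeasurable G (chartVolume e)) :
    ∫ x, G x ∂(chartVolume e) = ∫ y in e.target, volumeDensity e y * G (e.symm y) := by
  have hs : AEMeasurable e.symm ((volume.restrict e.target).withDensity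
      fun y => ENNReal.ofReal (volumeDensity e y)) :=
    (aemeasurable_symm e).mono_ac (withDensity_absolutelyContinuous _ _)
  rw [chartVolume, integral_map hs hG,
    integral_withDensity_eq_integral_toReal_smul₀ (aemeasurable_volumeDensity he).ennreal_ofReal
      (by simp)]
  refine integral_congr_ae (Filter.Eventually.of_forall fun y => ?_)
  exact congrArg (· * _) (ENNReal.toReal_ofReal (Real.sqrt_nonneg _))

theorem chartVolume_apply (he : e ∈ atlas 𝔼 M) {S : Set M} (hS : MeasurableSet S) :
    chartVolume e S =
      ∫⁻ y in e.target, ENNReal.ofReal (volumeDensity e y) * S.indicator 1 (e.symm y) := by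
  rw [← lintegral_chartVolume he (measurable_one.indicator hS), lintegral_indicator_one hS]

/-- The volumes of two charts agree on the overlap, by the change of variables formula. -/
theorem chartVolume_eq_of_subset (he : e ∈ atlas 𝔼 M) (he' : e' ∈ atlas 𝔼 M) {S : Set M}
    (hS : MeasurableSet S) (h1 : S ⊆ e.source) (h2 : S ⊆ e'.source) :
    chartVolume e S = chartVolume e' S := by
  set T := e.symm.trans e' with hT
  -- On either side only the points of the overlap contribute.
  have aux : ∀ e₁ e₂ : OpenPartialHomeomorph M 𝔼, S ⊆ e₂.source →
      ∫⁻ y in e₁.target, ENNReal.ofReal (volumeDensity e₁ y) * S.indicator 1 (e₁.symm y) =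
      ∫⁻ y in (e₁.symm.trans e₂).source,
        ENNReal.ofReal (volumeDensity e₁ y) * S.indicator 1 (e₁.symm y) := by
    intro e₁ e₂ h
    rw [← lintegral_indicator e₁.open_target.measurableSet,
      ← lintegral_indicator (e₁.symm.trans e₂).open_source.measurableSet]
    refine lintegral_congr fun y => ?_
    by_cases hy : y ∈ e₁.target
    · by_cases hy2 : e₁.symm y ∈ e₂.source
      · rw [indicator_of_mem hy,
          indicator_of_mem (show y ∈ (e₁.symm.trans e₂).source from ⟨hy, hy2⟩)]
      · rw [indicator_of_mem hy, indicator_of_notMem (s := (e₁.symm.trans e₂).source)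
          fun h' => hy2 h'.2, indicator_of_notMem (s := S) fun h' => hy2 (h h'), mul_zero]
    · rw [indicator_of_notMem hy, indicator_of_notMem fun h' => hy h'.1]
  rw [chartVolume_apply he hS, chartVolume_apply he' hS, aux e e' h2, aux e' e h1]
  have himg : T '' T.source = (e'.symm.trans e).source := by
    rw [T.image_source_eq_target, ← T.symm_source]
    simp [hT]
  have hder : ∀ y ∈ T.source, HasFDerivWithinAt T (fderiv ℝ T y) T.source y := by
    intro y hy
    have hτ : MDifferentiableAt (𝓡 m) (𝓡 m) T y :=
      (mdifferentiableAt_atlas (I := 𝓡 m) he' hy.2).comp y (mdifferentiableAt_symm he hy.1)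
    exact hτ.differentiableAt.hasFDerivAt.hasFDerivWithinAt
  rw [← himg, lintegral_image_eq_lintegral_abs_det_fderiv_mul volume T.open_source.measurableSet
    hder T.injOn]
  refine setLIntegral_congr_fun T.open_source.measurableSet fun y hy => ?_
  have h3 : e'.symm (T y) = e.symm y := e'.left_inv hy.2
  rw [h3, volumeDensity_transition he he' hy, ENNReal.ofReal_mul (abs_nonneg _), mul_assoc]

theorem chartVolume_compl_source (he : e ∈ atlas 𝔼 M) : chartVolume e e.sourceᶜ = 0 := by
  rw [chartVolume_apply he e.open_source.measurableSet.compl]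
  refine (setLIntegral_congr_fun e.open_target.measurableSet fun y hy => ?_).trans
    lintegral_zero
  rw [indicator_of_notMem (s := e.sourceᶜ) fun h => h (e.map_target hy), mul_zero]

/-- The supremum defining the Riemannian volume is attained on the domain of each chart: it is
bounded above by a measure glued from countably many charts, with the same restrictions. -/
theorem riemannianVolume_apply_of_subset [SigmaCompactSpace M] (he : e ∈ atlas 𝔼 M) {S : Set M}
    (hS : MeasurableSet S) (h : S ⊆ e.source) : riemannianVolume m M S = chartVolume e S := by
  refine le_antisymm ?_ ((le_iSup₂ (f := fun e (_ : e ∈ atlas 𝔼 M) => chartVolume e) e he) S)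
  rcases isEmpty_or_nonempty M with hM | hM
  · simp [eq_empty_of_isEmpty S]
  obtain ⟨c, hc, hcov⟩ := exists_countable_atlas_cover m M
  -- The measures of countably many charts, glued along a disjoint measurable partition.
  set A : ℕ → Set M := disjointed fun n => (c n).source with hA
  have hAm : ∀ n, MeasurableSet (A n) :=
    fun n => MeasurableSet.disjointed (fun i => (c i).open_source.measurableSet) n
  have hAs : ∀ n, A n ⊆ (c n).source := fun n => disjointed_subset _ n
  set μ : Measure M := Measure.sum fun n => (chartVolume (c n)).restrict (A n) with hμ
  have key : ∀ e₁ ∈ atlas 𝔼 M, ∀ S₁, MeasurableSet S₁ → S₁ ⊆ e₁.source →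
      μ S₁ = chartVolume e₁ S₁ := by
    intro e₁ he₁ S₁ hS₁ h₁
    rw [hμ, Measure.sum_apply _ hS₁]
    have hpart : S₁ = ⋃ n, S₁ ∩ A n := by
      rw [← inter_iUnion, hA, iUnion_disjointed, hcov, inter_univ]
    conv_rhs => rw [hpart]
    rw [measure_iUnion (fun i j hij => ((disjoint_disjointed _ hij).mono inter_subset_right
      inter_subset_right)) fun n => hS₁.inter (hAm n)]
    refine tsum_congr fun n => ?_
    rw [Measure.restrict_apply hS₁]
    exact chartVolume_eq_of_subset (hc n) he₁ (hS₁.inter (hAm n))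
      (inter_subset_right.trans (hAs n)) (inter_subset_left.trans h₁)
  have hle : riemannianVolume m M ≤ μ := by
    refine iSup₂_le fun e₁ he₁ => Measure.le_iff.2 fun S₁ hS₁ => ?_
    rw [← measure_inter_conull (chartVolume_compl_source he₁),
      ← key e₁ he₁ _ (hS₁.inter e₁.open_source.measurableSet) inter_subset_right]
    exact measure_mono inter_subset_left
  exact (hle S).trans_eq (key e he S hS h)

theorem riemannianVolume_restrict_source [SigmaCompactSpace M] (he : e ∈ atlas 𝔼 M) :
    (riemannianVolume m M).restrict e.source = chartVolume e := by
  ext S hS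
  rw [Measure.restrict_apply hS, riemannianVolume_apply_of_subset he
    (hS.inter e.open_source.measurableSet) inter_subset_right]
  exact measure_inter_conull (chartVolume_compl_source he)

instance isLocallyFiniteMeasure_riemannianVolume [SigmaCompactSpace M] :
    IsLocallyFiniteMeasure (riemannianVolume m M) where
  finiteAtNhds x := by
    set e := chartAt 𝔼 x
    have he : e ∈ atlas 𝔼 M := chart_mem_atlas _ _
    have hx : x ∈ e.source := mem_chart_source _ _
    obtain ⟨r, hr, hball⟩ := Metric.nhds_basis_closedBall.mem_iff.1
      (e.open_target.mem_nhds (e.map_source hx))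
    have hopen : IsOpen (e.source ∩ e ⁻¹' Metric.ball (e x) r) :=
      e.isOpen_inter_preimage Metric.isOpen_ball
    refine ⟨e.source ∩ e ⁻¹' Metric.ball (e x) r,
      hopen.mem_nhds ⟨hx, Metric.mem_ball_self hr⟩, ?_⟩
    rw [riemannianVolume_apply_of_subset he hopen.measurableSet inter_subset_left,
      chartVolume_apply he hopen.measurableSet]
    have hint : IntegrableOn (volumeDensity e) (Metric.closedBall (e x) r) :=
      ((contDiffOn_volumeDensity he).continuousOn.mono hball).integrableOn_compact
        (isCompact_closedBall _ _)
    refine lt_of_le_of_lt ?_ hint.lintegral_lt_top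
    rw [← lintegral_indicator e.open_target.measurableSet,
      ← lintegral_indicator measurableSet_closedBall]
    refine lintegral_mono fun y => ?_
    by_cases hy : y ∈ e.target
    · rw [indicator_of_mem hy]
      by_cases hy2 : y ∈ Metric.closedBall (e x) r
      · rw [indicator_of_mem hy2]
        refine mul_le_of_le_one_right' ?_
        exact indicator_le_self' (fun _ _ => zero_le) _
      · rw [indicator_of_notMem (a := e.symm y), mul_zero]
        · exact zero_le
        · rintro ⟨-, h⟩
          rw [mem_preimage, e.right_inv hy] at h
          exact hy2 (Metric.ball_subset_closedBall h)
    · rw [indicator_of_notMem hy]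
      exact zero_le

instance isFiniteMeasure_riemannianVolume [CompactSpace M] :
    IsFiniteMeasure (riemannianVolume m M) :=
  ⟨isCompact_univ.measure_lt_top⟩

instance isOpenPosMeasure_riemannianVolume : (riemannianVolume m M).IsOpenPosMeasure where
  open_pos U hU := by
    rintro ⟨x, hxU⟩ h0
    set e := chartAt 𝔼 x
    have he : e ∈ atlas 𝔼 M := chart_mem_atlas _ _
    have hx : x ∈ e.source := mem_chart_source _ _
    have h1 : chartVolume e U = 0 := le_antisymm (h0 ▸
      (le_iSup₂ (f := fun e (_ : e ∈ atlas 𝔼 M) => chartVolume e) e he) U) zero_le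
    have hopen : IsOpen (e.target ∩ e.symm ⁻¹' U) := e.isOpen_inter_preimage_symm hU
    have hpos : 0 < volume (e.target ∩ e.symm ⁻¹' U) :=
      hopen.measure_pos _ ⟨e x, e.map_source hx, by simpa [e.left_inv hx] using hxU⟩
    rw [chartVolume_apply he hU.measurableSet] at h1
    have h2 : ∫⁻ y in e.target ∩ e.symm ⁻¹' U, ENNReal.ofReal (volumeDensity e y) = 0 := by
      refine le_antisymm (h1 ▸ ?_) zero_le
      refine le_trans (le_of_eq ?_) (lintegral_mono_set (s := e.target ∩ e.symm ⁻¹' U)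
        inter_subset_left)
      refine setLIntegral_congr_fun hopen.measurableSet fun y hy => ?_
      rw [indicator_of_mem (s := U) hy.2, Pi.one_apply, mul_one]
    rw [lintegral_eq_zero_iff' ((aemeasurable_volumeDensity he).mono_measure
      (Measure.restrict_mono inter_subset_left le_rfl)).ennreal_ofReal] at h2
    have h3 : ∀ᵐ y ∂(volume.restrict (e.target ∩ e.symm ⁻¹' U)), False := by
      filter_upwards [h2, ae_restrict_mem hopen.measurableSet] with y hy1 hy2
      exact (ENNReal.ofReal_pos.2 (volumeDensity_pos he hy2.1)).ne' hy1
    rw [Filter.eventually_false_iff_eq_bot, ae_eq_bot, Measure.restrict_eq_zero] at h3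
    exact hpos.ne' h3

end Volume

/-! ### The weak form of the eigenvalue equation -/

section WeakForm

theorem integrable_mul_of_tsupport_subset {E : Type*} [NormedAddCommGroup E] [MeasurableSpace E]
    [OpensMeasurableSpace E] {μ : Measure E} [IsFiniteMeasureOnCompacts μ] {U : Set E}
    (hU : IsOpen U) {a u : E → ℝ} (ha : ContinuousOn a U) (hu : Continuous u)
    (hc : HasCompactSupport u) (hsub : tsupport u ⊆ U) : Integrable (fun y => a y * u y) μ := by
  have hcont : Continuous fun y => a y * u y :=
    (ha.mul hu.continuousOn).continuous_of_tsupport_subset hU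
      ((tsupport_mul_subset_right (f := a) (g := u)).trans hsub)
  exact hcont.integrable_of_hasCompactSupport hc.mul_left

variable {m : ℕ} {M : Type*} [TopologicalSpace M] [ChartedSpace (EuclideanSpace ℝ (Fin m)) M]
  {e : OpenPartialHomeomorph M (EuclideanSpace ℝ (Fin m))}

local notation "𝔼" => EuclideanSpace ℝ (Fin m)

theorem contDiffOn_comp_symm [IsManifold (𝓡 m) ∞ M] (he : e ∈ atlas 𝔼 M) {f : M → ℝ}
    (hf : ContMDiff (𝓡 m) 𝓘(ℝ, ℝ) ∞ f) : ContDiffOn ℝ ∞ (f ∘ e.symm) e.target := by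
  rw [← contMDiffOn_iff_contDiffOn]
  exact hf.comp_contMDiffOn
    (contMDiffOn_symm_of_mem_maximalAtlas (IsManifold.subset_maximalAtlas he))

theorem contDiffOn_fderiv_comp_symm [IsManifold (𝓡 m) ∞ M] (he : e ∈ atlas 𝔼 M) {f : M → ℝ}
    (hf : ContMDiff (𝓡 m) 𝓘(ℝ, ℝ) ∞ f) (v : 𝔼) :
    ContDiffOn ℝ ∞ (fun y => fderiv ℝ (f ∘ e.symm) y v) e.target :=
  ((contDiffOn_comp_symm he hf).fderiv_of_isOpen e.open_target le_rfl).clm_apply contDiffOn_const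

variable [RiemannianBundle (fun x : M => TangentSpace (𝓡 m) x)]

variable (m) in
/-- The function `g(∇f, ∇h) = dh(∇f)`. -/
def gradPairing (f h : M → ℝ) (x : M) : ℝ :=
  mfderiv (𝓡 m) 𝓘(ℝ, ℝ) h x (riemannianGradient f x)

/-- The component `√(det g) ∑ⱼ gⁱʲ ∂ⱼ f` of the flux whose divergence defines the Laplacian. -/
def flux (e : OpenPartialHomeomorph M 𝔼) (f : M → ℝ) (i : Fin m) (y : 𝔼) : ℝ :=
  volumeDensity e y * ∑ j, (metricMatrix e y)⁻¹ i j *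
    fderiv ℝ (f ∘ e.symm) y (EuclideanSpace.single j (1 : ℝ))

theorem gradPairing_self (f : M → ℝ) (x : M) :
    gradPairing m f f x = ‖riemannianGradient (m := m) f x‖ ^ 2 := by
  rw [← real_inner_self_eq_norm_sq, inner_riemannianGradient, gradPairing]

theorem gradPairing_add_right (f : M → ℝ) {h k : M → ℝ} (hh : ContMDiff (𝓡 m) 𝓘(ℝ, ℝ) ∞ h)
    (hk : ContMDiff (𝓡 m) 𝓘(ℝ, ℝ) ∞ k) (x : M) :
    gradPairing m f (h + k) x = gradPairing m f h x + gradPairing m f k x := by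
  rw [gradPairing, mfderiv_add (hh.mdifferentiable (by simp) x) (hk.mdifferentiable (by simp) x)]
  rfl

theorem gradPairing_const_right (f : M → ℝ) (c : ℝ) (x : M) :
    gradPairing m f (fun _ => c) x = 0 := by
  rw [gradPairing, mfderiv_const]
  rfl

variable [IsManifold (𝓡 m) ∞ M]

theorem volumeDensity_mul_gradPairing (he : e ∈ atlas 𝔼 M) {f h : M → ℝ}
    (hf : ContMDiff (𝓡 m) 𝓘(ℝ, ℝ) ∞ f) (hh : ContMDiff (𝓡 m) 𝓘(ℝ, ℝ) ∞ h) {y : 𝔼}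
    (hy : y ∈ e.target) :
    volumeDensity e y * gradPairing m f h (e.symm y) =
      ∑ i, flux e f i y * fderiv ℝ (h ∘ e.symm) y (EuclideanSpace.single i (1 : ℝ)) := by
  rw [gradPairing]
  refine (congrArg (volumeDensity e y * ·) (mfderiv_riemannianGradient he hy
    (hf.mdifferentiable (by simp) _) (hh.mdifferentiable (by simp) _))).trans ?_
  rw [Finset.mul_sum]
  exact Finset.sum_congr rfl fun i _ => (mul_assoc _ _ _).symm

theorem volumeDensity_mul_laplacianInChart (he : e ∈ atlas 𝔼 M) (f : M → ℝ) {y : 𝔼}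
    (hy : y ∈ e.target) : volumeDensity e y * laplacianInChart e f y =
      ∑ i, fderiv ℝ (flux e f i) y (EuclideanSpace.single i (1 : ℝ)) := by
  rw [laplacianInChart, mul_inv_cancel_left₀ (volumeDensity_pos he hy).ne']
  rfl

variable [IsContMDiffRiemannianBundle (𝓡 m) ∞ (EuclideanSpace ℝ (Fin m))
    (fun x : M => TangentSpace (𝓡 m) x)]

theorem contDiffOn_flux (he : e ∈ atlas 𝔼 M) {f : M → ℝ}
    (hf : ContMDiff (𝓡 m) 𝓘(ℝ, ℝ) ∞ f) (i : Fin m) : ContDiffOn ℝ ∞ (flux e f i) e.target :=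
  (contDiffOn_volumeDensity he).mul (ContDiffOn.sum fun _ _ =>
    (contDiffOn_metricMatrix_inv he _ _).mul (contDiffOn_fderiv_comp_symm he hf _))

theorem continuous_gradPairing {f h : M → ℝ} (hf : ContMDiff (𝓡 m) 𝓘(ℝ, ℝ) ∞ f)
    (hh : ContMDiff (𝓡 m) 𝓘(ℝ, ℝ) ∞ h) : Continuous (gradPairing m f h) := by
  rw [continuous_iff_continuousAt]
  intro x
  set e := chartAt 𝔼 x
  have he : e ∈ atlas 𝔼 M := chart_mem_atlas _ _
  have hx : x ∈ e.source := mem_chart_source _ _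
  have h1 : ContinuousOn (fun y => (volumeDensity e y)⁻¹ * ∑ i, flux e f i y *
      fderiv ℝ (h ∘ e.symm) y (EuclideanSpace.single i (1 : ℝ))) e.target :=
    ((contDiffOn_volumeDensity he).continuousOn.inv₀ fun y hy => (volumeDensity_pos he hy).ne').mul
      (continuousOn_finsetSum _ fun i _ => (contDiffOn_flux he hf i).continuousOn.mul
        (contDiffOn_fderiv_comp_symm he hh _).continuousOn)
  have h2 := h1.comp e.continuousOn e.mapsTo
  refine (h2.congr fun z hz => ?_).continuousAt (e.open_source.mem_nhds hx)
  simp only [Function.comp]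
  rw [← volumeDensity_mul_gradPairing he hf hh (e.map_source hz),
    inv_mul_cancel_left₀ (volumeDensity_pos he (e.map_source hz)).ne', e.left_inv hz]

variable [MeasurableSpace M] [BorelSpace M]

theorem integral_riemannianVolume_of_support_subset [SigmaCompactSpace M] (he : e ∈ atlas 𝔼 M)
    {G : M → ℝ} (hG : Continuous G) (hs : ∀ x ∉ e.source, G x = 0) :
    ∫ x, G x ∂(riemannianVolume m M) = ∫ y in e.target, volumeDensity e y * G (e.symm y) := by
  rw [← setIntegral_eq_integral_of_forall_compl_eq_zero hs, riemannianVolume_restrict_source he,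
    integral_chartVolume he hG.aestronglyMeasurable]

/-- The weak form of `-Δ_g f = lam f` for a test function supported in one chart, where it is
integration by parts for the components of the flux. -/
theorem integral_gradPairing_of_tsupport_subset [T2Space M] [CompactSpace M] (he : e ∈ atlas 𝔼 M)
    {lam : ℝ} {f h : M → ℝ} (hf : ContMDiff (𝓡 m) 𝓘(ℝ, ℝ) ∞ f)
    (hev : ∀ y ∈ e.target, -laplacianInChart e f y = lam * f (e.symm y))
    (hh : ContMDiff (𝓡 m) 𝓘(ℝ, ℝ) ∞ h) (hs : tsupport h ⊆ e.source) :
    ∫ x, gradPairing m f h x ∂(riemannianVolume m M) =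
      lam * ∫ x, f x * h x ∂(riemannianVolume m M) := by
  -- The test function in coordinates, extended by zero to a smooth function on the whole space.
  set g : 𝔼 → ℝ := e.target.indicator (h ∘ e.symm) with hg
  set K : Set 𝔼 := e '' tsupport h with hK
  have hKc : IsCompact K :=
    (isClosed_tsupport h).isCompact.image_of_continuousOn (e.continuousOn.mono hs)
  have hKt : K ⊆ e.target := by
    rintro _ ⟨x, hx, rfl⟩
    exact e.map_source (hs hx)
  have hg0 : ∀ y ∉ K, g y = 0 := by
    intro y hy
    by_cases hyt : y ∈ e.target
    · rw [hg, indicator_of_mem hyt]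
      refine image_eq_zero_of_notMem_tsupport (f := h) fun hmem => hy ⟨_, hmem, e.right_inv hyt⟩
    · rw [hg, indicator_of_notMem hyt]
  have hgK : tsupport g ⊆ K :=
    closure_minimal (fun y hy => by_contra fun h' => hy (hg0 y h')) hKc.isClosed
  have hgt : tsupport g ⊆ e.target := hgK.trans hKt
  have hgc : HasCompactSupport g := hKc.of_isClosed_subset (isClosed_tsupport g) hgK
  have hgeq : ∀ y ∈ e.target, g =ᶠ[nhds y] h ∘ e.symm := fun y hy => by
    filter_upwards [e.open_target.mem_nhds hy] with z hz
    exact indicator_of_mem hz _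
  have hgs : ContDiff ℝ ∞ g := by
    rw [contDiff_iff_contDiffAt]
    intro y
    by_cases hy : y ∈ e.target
    · exact ((contDiffOn_comp_symm he hh).contDiffAt
        (e.open_target.mem_nhds hy)).congr_of_eventuallyEq (hgeq y hy)
    · refine contDiffAt_const (c := (0 : ℝ)) |>.congr_of_eventuallyEq ?_
      filter_upwards [hKc.isClosed.isOpen_compl.mem_nhds fun h' => hy (hKt h')] with z hz
      exact hg0 z hz
  set v : Fin m → 𝔼 := fun i => EuclideanSpace.single i (1 : ℝ) with hv
  have hgd : ∀ i, Continuous fun y => fderiv ℝ g y (v i) := fun i =>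
    (hgs.continuous_fderiv (by simp)).clm_apply continuous_const
  have hgdc : ∀ i, HasCompactSupport fun y => fderiv ℝ g y (v i) := fun i =>
    hgc.fderiv_apply ℝ (v i)
  have hgds : ∀ i, tsupport (fun y => fderiv ℝ g y (v i)) ⊆ e.target := fun i =>
    (tsupport_fderiv_apply_subset ℝ (v i)).trans hgt
  have hfl : ∀ i, ContDiffOn ℝ ∞ (flux e f i) e.target := contDiffOn_flux he hf
  have hfld : ∀ i, ContinuousOn (fun y => fderiv ℝ (flux e f i) y (v i)) e.target := fun i =>
    ((hfl i).continuousOn_fderiv_of_isOpen e.open_target (by simp)).clm_apply continuousOn_const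
  have hi1 : ∀ i, Integrable (fun y => flux e f i y * fderiv ℝ g y (v i)) := fun i =>
    integrable_mul_of_tsupport_subset e.open_target (hfl i).continuousOn (hgd i) (hgdc i) (hgds i)
  have hi2 : ∀ i, Integrable (fun y => fderiv ℝ (flux e f i) y (v i) * g y) := fun i =>
    integrable_mul_of_tsupport_subset e.open_target (hfld i) hgs.continuous hgc hgt
  have hi3 : ∀ i, Integrable (fun y => flux e f i y * g y) := fun i =>
    integrable_mul_of_tsupport_subset e.open_target (hfl i).continuousOn hgs.continuous hgc hgt
  have hparts : ∀ i, ∫ y, flux e f i y * fderiv ℝ g y (v i) =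
      -∫ y, fderiv ℝ (flux e f i) y (v i) * g y := fun i =>
    integral_mul_fderiv_eq_neg_fderiv_mul_of_integrable (hi2 i) (hi1 i) (hi3 i)
      (fun y hy => ((hfl i).contDiffAt (e.open_target.mem_nhds (hgt hy))).differentiableAt
        (by simp))
      (fun y _ => hgs.differentiable (by simp) y)
  have hzero : ∀ x ∉ e.source, h x = 0 := fun x hx =>
    image_eq_zero_of_notMem_tsupport fun h' => hx (hs h')
  have hGzero : ∀ x ∉ e.source, gradPairing m f h x = 0 := fun x hx => by
    have hev : h =ᶠ[nhds x] fun _ => (0 : ℝ) :=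
      notMem_tsupport_iff_eventuallyEq.1 fun h' => hx (hs h')
    rw [gradPairing, hev.mfderiv_eq, mfderiv_const]
    rfl
  calc ∫ x, gradPairing m f h x ∂(riemannianVolume m M)
      = ∫ y in e.target, ∑ i, flux e f i y * fderiv ℝ g y (v i) := by
        rw [integral_riemannianVolume_of_support_subset he (continuous_gradPairing hf hh) hGzero]
        refine setIntegral_congr_fun e.open_target.measurableSet fun y hy => ?_
        rw [volumeDensity_mul_gradPairing he hf hh hy]
        simp only [(hgeq y hy).fderiv_eq, hv]
    _ = ∫ y, ∑ i, flux e f i y * fderiv ℝ g y (v i) := by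
        refine setIntegral_eq_integral_of_forall_compl_eq_zero fun y hy => ?_
        refine Finset.sum_eq_zero fun i _ => ?_
        rw [image_eq_zero_of_notMem_tsupport (f := fun y => fderiv ℝ g y (v i))
          fun h' => hy (hgds i h'), mul_zero]
    _ = -∫ y, ∑ i, fderiv ℝ (flux e f i) y (v i) * g y := by
        rw [integral_finsetSum _ fun i _ => hi1 i, integral_finsetSum _ fun i _ => hi2 i,
          ← Finset.sum_neg_distrib]
        exact Finset.sum_congr rfl fun i _ => hparts i
    _ = -∫ y in e.target, ∑ i, fderiv ℝ (flux e f i) y (v i) * g y := by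
        rw [setIntegral_eq_integral_of_forall_compl_eq_zero fun y hy => ?_]
        refine Finset.sum_eq_zero fun i _ => ?_
        rw [hg, indicator_of_notMem hy, mul_zero]
    _ = ∫ y in e.target, volumeDensity e y * (lam * (f (e.symm y) * h (e.symm y))) := by
        rw [← integral_neg]
        refine setIntegral_congr_fun e.open_target.measurableSet fun y hy => ?_
        rw [← Finset.sum_mul, ← volumeDensity_mul_laplacianInChart he f hy, hg,
          indicator_of_mem hy, Function.comp, ← mul_assoc lam, ← hev y hy]
        ring
    _ = lam * ∫ x, f x * h x ∂(riemannianVolume m M) := by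
        rw [← integral_const_mul, integral_riemannianVolume_of_support_subset he
          (G := fun x => lam * (f x * h x))
          (continuous_const.mul (hf.continuous.mul hh.continuous))
          fun x hx => by simp [hzero x hx]]

/-- The weak form of `-Δ_g f = lam f`, tested against smooth functions. -/
theorem integral_gradPairing [T2Space M] [CompactSpace M] {lam : ℝ} {f h : M → ℝ}
    (hf : ContMDiff (𝓡 m) 𝓘(ℝ, ℝ) ∞ f)
    (hev : ∀ e ∈ atlas 𝔼 M, ∀ y ∈ e.target, -laplacianInChart e f y = lam * f (e.symm y))
    (hh : ContMDiff (𝓡 m) 𝓘(ℝ, ℝ) ∞ h) :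
    ∫ x, gradPairing m f h x ∂(riemannianVolume m M) =
      lam * ∫ x, f x * h x ∂(riemannianVolume m M) := by
  obtain ⟨t, ht⟩ := CompactSpace.elim_nhds_subcover (fun x : M => (chartAt 𝔼 x).source)
    fun x => (chartAt 𝔼 x).open_source.mem_nhds (mem_chart_source 𝔼 x)
  obtain ⟨ρ, hρ⟩ := SmoothPartitionOfUnity.exists_isSubordinate (𝓡 m) isClosed_univ
    (fun i : t => (chartAt 𝔼 (i : M)).source) (fun i => (chartAt 𝔼 (i : M)).open_source)
    (fun x _ => by simpa using ht.ge (mem_univ x))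
  have hρh : ∀ i, ContMDiff (𝓡 m) 𝓘(ℝ, ℝ) ∞ fun x => ρ i x * h x := fun i =>
    (ρ i).contMDiff.mul hh
  have hint : ∀ {G : M → ℝ}, Continuous G → Integrable G (riemannianVolume m M) := fun hG =>
    hG.integrable_of_hasCompactSupport (HasCompactSupport.of_compactSpace _)
  have key : ∀ s : Finset t, ContMDiff (𝓡 m) 𝓘(ℝ, ℝ) ∞ (∑ i ∈ s, fun x => ρ i x * h x) ∧
      ∫ x, gradPairing m f (∑ i ∈ s, fun x => ρ i x * h x) x ∂(riemannianVolume m M) =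
      lam * ∫ x, f x * (∑ i ∈ s, fun x => ρ i x * h x) x ∂(riemannianVolume m M) := by
    intro s
    classical
    induction s using Finset.induction_on with
    | empty =>
      refine ⟨contMDiff_const, ?_⟩
      have : ∀ x, gradPairing m f (0 : M → ℝ) x = 0 := gradPairing_const_right f 0
      simp [this]
    | insert i s hi ih =>
      obtain ⟨ih1, ih2⟩ := ih
      rw [Finset.sum_insert hi]
      refine ⟨(hρh i).add ih1, ?_⟩
      have hloc := integral_gradPairing_of_tsupport_subset (chart_mem_atlas 𝔼 (i : M)) hf
        (hev _ (chart_mem_atlas 𝔼 (i : M))) (hρh i)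
        ((tsupport_mul_subset_left (f := ρ i) (g := h)).trans (hρ i))
      simp only [gradPairing_add_right f (hρh i) ih1, Pi.add_apply, mul_add]
      rw [integral_add (hint (continuous_gradPairing hf (hρh i)))
        (hint (continuous_gradPairing hf ih1)), hloc, ih2, integral_add, mul_add]
      · exact hint (hf.continuous.mul (hρh i).continuous)
      · exact hint (hf.continuous.mul ih1.continuous)
  have hsum : (∑ i, fun x => ρ i x * h x) = h := by
    ext x
    rw [Finset.sum_apply, ← Finset.sum_mul, ← finsum_eq_sum_of_fintype, ρ.sum_eq_one (mem_univ x),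
      one_mul]
  have := (key Finset.univ).2
  rwa [hsum] at this

end WeakForm

/-! ### The profile on the line -/

section Profile

theorem integrable_exp_neg_mul_abs {c : ℝ} (hc : 0 < c) :
    Integrable fun s : ℝ => Real.exp (-c * |s|) := by
  have hpos : IntegrableOn (fun s : ℝ => Real.exp (-c * |s|)) (Ioi 0) :=
    (exp_neg_integrableOn_Ioi 0 hc).congr_fun
      (fun s hs => by simp only [abs_of_pos (mem_Ioi.1 hs)]) measurableSet_Ioi
  have hneg : IntegrableOn (fun s : ℝ => Real.exp (-c * |s|)) (Iio 0) := by
    have h := IntegrableOn.comp_neg_Iio (c := 0) (f := fun s : ℝ => Real.exp (-c * |s|))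
      (by simpa using hpos)
    simpa only [abs_neg] using h
  rw [← integrableOn_univ, ← Iic_union_Ioi (a := (0 : ℝ))]
  exact ((integrableOn_Iic_iff_integrableOn_Iio (by simp)).2 hneg).union hpos

theorem cosh_rpow_neg_le (x : ℝ) {q : ℝ} (hq : 0 ≤ q) :
    Real.cosh x ^ (-q) ≤ 2 ^ q * Real.exp (-q * |x|) := by
  have h1 : Real.exp |x| / 2 ≤ Real.cosh x := by
    rw [← Real.cosh_abs, Real.cosh_eq]
    have := Real.exp_pos (-|x|)
    linarith
  calc Real.cosh x ^ (-q) ≤ (Real.exp |x| / 2) ^ (-q) :=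
        Real.rpow_le_rpow_of_nonpos (by positivity) h1 (by linarith)
    _ = 2 ^ q * Real.exp (-q * |x|) := by
        rw [Real.div_rpow (Real.exp_pos _).le zero_le_two, ← Real.exp_mul,
          Real.rpow_neg zero_le_two, div_inv_eq_mul, mul_comm, mul_comm |x|]

/-- The logarithmic derivative of the profile `phiLam p Lam`, up to the factor `-√Lam`. -/
def phiTanh (p Lam s : ℝ) : ℝ := Real.tanh ((p - 2) / 2 * √Lam * s)

theorem continuous_phiTanh (p Lam : ℝ) : Continuous (phiTanh p Lam) := by
  have h : phiTanh p Lam = fun s => Real.sinh ((p - 2) / 2 * √Lam * s) /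
      Real.cosh ((p - 2) / 2 * √Lam * s) := funext fun s => Real.tanh_eq_sinh_div_cosh _
  rw [h]
  exact (Real.continuous_sinh.comp (by fun_prop)).div (Real.continuous_cosh.comp (by fun_prop))
    fun s => (Real.cosh_pos _).ne'

theorem one_sub_phiTanh_sq (p Lam s : ℝ) :
    1 - phiTanh p Lam s ^ 2 = (Real.cosh ((p - 2) / 2 * √Lam * s) ^ 2)⁻¹ := by
  have h := Real.cosh_pos ((p - 2) / 2 * √Lam * s)
  rw [phiTanh, Real.tanh_eq_sinh_div_cosh, div_pow, Real.sinh_sq]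
  field_simp
  ring

theorem phiTanh_sq_le_one (p Lam s : ℝ) : phiTanh p Lam s ^ 2 ≤ 1 := by
  have h := one_sub_phiTanh_sq p Lam s
  have : 0 ≤ (Real.cosh ((p - 2) / 2 * √Lam * s) ^ 2)⁻¹ := by positivity
  linarith

theorem hasDerivAt_phiTanh (p Lam s : ℝ) :
    HasDerivAt (phiTanh p Lam) ((p - 2) / 2 * √Lam * (1 - phiTanh p Lam s ^ 2)) s := by
  have h : phiTanh p Lam = fun s => Real.sinh ((p - 2) / 2 * √Lam * s) /
      Real.cosh ((p - 2) / 2 * √Lam * s) := funext fun s => Real.tanh_eq_sinh_div_cosh _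
  have hc := Real.cosh_pos ((p - 2) / 2 * √Lam * s)
  have hl : HasDerivAt (fun s => (p - 2) / 2 * √Lam * s) ((p - 2) / 2 * √Lam) s := by
    simpa using (hasDerivAt_id s).const_mul ((p - 2) / 2 * √Lam)
  rw [one_sub_phiTanh_sq, h]
  refine (hl.sinh.div hl.cosh hc.ne').congr_deriv ?_
  rw [← div_eq_mul_inv]
  congr 1
  linear_combination ((p - 2) / 2 * √Lam) * Real.cosh_sq ((p - 2) / 2 * √Lam * s)

variable {p Lam : ℝ}

theorem phiLam_pos (hp : 2 < p) (hL : 0 < Lam) (s : ℝ) : 0 < phiLam p Lam s :=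
  mul_pos (Real.rpow_pos_of_pos (by positivity) _) (Real.rpow_pos_of_pos (Real.cosh_pos _) _)

theorem contDiff_phiLam : ContDiff ℝ ∞ (phiLam p Lam) := by
  refine contDiff_const.mul (ContDiff.rpow_const_of_ne ?_ fun s => (Real.cosh_pos _).ne')
  exact Real.contDiff_cosh.comp (contDiff_const.mul contDiff_id)

theorem hasDerivAt_phiLam (hp : 2 < p) (s : ℝ) :
    HasDerivAt (phiLam p Lam) (-(√Lam * phiTanh p Lam s * phiLam p Lam s)) s := by
  have hc := Real.cosh_pos ((p - 2) / 2 * √Lam * s)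
  have hl : HasDerivAt (fun s => (p - 2) / 2 * √Lam * s) ((p - 2) / 2 * √Lam) s := by
    simpa using (hasDerivAt_id s).const_mul ((p - 2) / 2 * √Lam)
  refine ((hl.cosh.rpow_const (p := -(2 / (p - 2))) (Or.inl hc.ne')).const_mul
    ((p / 2 * Lam) ^ (1 / (p - 2)))).congr_deriv ?_
  have hp' : p - 2 ≠ 0 := by linarith
  rw [phiTanh, phiLam, Real.tanh_eq_sinh_div_cosh, Real.rpow_sub_one hc.ne']
  field_simp

theorem deriv_phiLam (hp : 2 < p) (s : ℝ) :
    deriv (phiLam p Lam) s = -(√Lam * phiTanh p Lam s * phiLam p Lam s) :=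
  (hasDerivAt_phiLam hp s).deriv

theorem hasDerivAt_phiLam_rpow (hp : 2 < p) (hL : 0 < Lam) (q s : ℝ) :
    HasDerivAt (fun s => phiLam p Lam s ^ q)
      (-(q * √Lam * phiTanh p Lam s * phiLam p Lam s ^ q)) s := by
  have h := phiLam_pos hp hL s
  refine ((hasDerivAt_phiLam hp s).rpow_const (p := q) (Or.inl h.ne')).congr_deriv ?_
  rw [Real.rpow_sub_one h.ne']
  field_simp

theorem contDiff_phiLam_rpow (hp : 2 < p) (hL : 0 < Lam) (q : ℝ) :
    ContDiff ℝ ∞ fun s => phiLam p Lam s ^ q :=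
  contDiff_phiLam.rpow_const_of_ne fun s => (phiLam_pos hp hL s).ne'

theorem phiLam_rpow_sub_two (hp : 2 < p) (hL : 0 < Lam) (s : ℝ) :
    phiLam p Lam s ^ (p - 2) = p / 2 * Lam * (1 - phiTanh p Lam s ^ 2) := by
  have hc := Real.cosh_pos ((p - 2) / 2 * √Lam * s)
  have hb : 0 < p / 2 * Lam := by positivity
  have hp' : p - 2 ≠ 0 := by linarith
  rw [one_sub_phiTanh_sq, phiLam, Real.mul_rpow (by positivity) (by positivity),
    ← Real.rpow_mul hb.le, ← Real.rpow_mul hc.le, one_div_mul_cancel hp', Real.rpow_one,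
    neg_mul, div_mul_cancel₀ _ hp', Real.rpow_neg hc.le, Real.rpow_two]

theorem phiLam_le (hp : 2 < p) (hL : 0 < Lam) (s : ℝ) :
    phiLam p Lam s ≤ (p / 2 * Lam) ^ (1 / (p - 2)) := by
  have hp' : 0 < p - 2 := by linarith
  refine mul_le_of_le_one_right (by positivity) ?_
  exact Real.rpow_le_one_of_one_le_of_nonpos (Real.one_le_cosh _)
    (by rw [neg_nonpos]; positivity)

/-- Positive powers of the profile decay exponentially. -/
theorem integrable_mul_phiLam_rpow (hp : 2 < p) (hL : 0 < Lam) {q : ℝ} (hq : 0 < q) {b : ℝ → ℝ}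
    (hb : Continuous b) {K : ℝ} (hK : ∀ s, |b s| ≤ K) :
    Integrable fun s => b s * phiLam p Lam s ^ q := by
  have hp' : 0 < p - 2 := by linarith
  have hB : 0 < p / 2 * Lam := by positivity
  have hr : 0 < 2 / (p - 2) * q := by positivity
  have ha : 0 < (p - 2) / 2 * √Lam := mul_pos (by linarith) (Real.sqrt_pos.2 hL)
  have hint : Integrable fun s => phiLam p Lam s ^ q := by
    refine ((integrable_exp_neg_mul_abs (mul_pos hr ha)).const_mul
      (((p / 2 * Lam) ^ (1 / (p - 2))) ^ q * 2 ^ (2 / (p - 2) * q))).mono'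
      (contDiff_phiLam_rpow hp hL q).continuous.aestronglyMeasurable
      (Filter.Eventually.of_forall fun s => ?_)
    rw [Real.norm_of_nonneg (Real.rpow_nonneg (phiLam_pos hp hL s).le _), phiLam,
      Real.mul_rpow (by positivity) (by positivity), ← Real.rpow_mul (Real.cosh_pos _).le, neg_mul,
      mul_assoc ((_ : ℝ) ^ q)]
    refine mul_le_mul_of_nonneg_left ((cosh_rpow_neg_le _ hr.le).trans_eq ?_) (by positivity)
    rw [abs_mul, abs_of_pos ha]
    ring_nf
  exact hint.bdd_mul hb.aestronglyMeasurable (Filter.Eventually.of_forall hK)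

theorem integrable_phiLam_rpow (hp : 2 < p) (hL : 0 < Lam) {q : ℝ} (hq : 0 < q) :
    Integrable fun s => phiLam p Lam s ^ q := by
  simpa using integrable_mul_phiLam_rpow hp hL hq (continuous_const (y := (1 : ℝ))) (K := 1)
    (by simp)

theorem integrable_phiTanh_sq_mul (hp : 2 < p) (hL : 0 < Lam) {q : ℝ} (hq : 0 < q) :
    Integrable fun s => phiTanh p Lam s ^ 2 * phiLam p Lam s ^ q :=
  integrable_mul_phiLam_rpow hp hL hq ((continuous_phiTanh p Lam).pow 2) (K := 1) fun s => by
    rw [abs_of_nonneg (sq_nonneg _)]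
    exact phiTanh_sq_le_one p Lam s

/-- The virial identity obtained by integrating the derivative of `phiTanh * phiLam ^ q`. -/
theorem integral_phiLam_rpow_virial (hp : 2 < p) (hL : 0 < Lam) {q : ℝ} (hq : 0 < q) :
    (p - 2) / 2 * ((∫ s, phiLam p Lam s ^ q) - ∫ s, phiTanh p Lam s ^ 2 * phiLam p Lam s ^ q) =
      q * ∫ s, phiTanh p Lam s ^ 2 * phiLam p Lam s ^ q := by
  have hi := integrable_phiLam_rpow hp hL hq
  have hj := integrable_phiTanh_sq_mul hp hL hq
  have hd : ∀ s, HasDerivAt (fun s => phiTanh p Lam s * phiLam p Lam s ^ q)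
      (√Lam * ((p - 2) / 2 * (phiLam p Lam s ^ q - phiTanh p Lam s ^ 2 * phiLam p Lam s ^ q) -
        q * (phiTanh p Lam s ^ 2 * phiLam p Lam s ^ q))) s := fun s =>
    ((hasDerivAt_phiTanh p Lam s).mul (hasDerivAt_phiLam_rpow hp hL q s)).congr_deriv (by ring)
  have h0 := integral_eq_zero_of_hasDerivAt_of_integrable hd
    ((((hi.sub hj).const_mul _).sub (hj.const_mul _)).const_mul _)
    (integrable_mul_phiLam_rpow hp hL hq (continuous_phiTanh p Lam) (K := 1) fun s =>
      abs_le_one_iff_mul_self_le_one.2 (by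
        have := phiTanh_sq_le_one p Lam s
        rwa [sq] at this))
  rw [integral_const_mul, integral_sub (by exact (hi.sub hj).const_mul _) (hj.const_mul _),
    integral_const_mul, integral_const_mul, integral_sub hi hj] at h0
  have := (mul_eq_zero.1 h0).resolve_left (Real.sqrt_pos.2 hL).ne'
  linarith

theorem sq_deriv_phiLam (hp : 2 < p) (hL : 0 < Lam) (s : ℝ) :
    deriv (phiLam p Lam) s ^ 2 = Lam * (phiTanh p Lam s ^ 2 * phiLam p Lam s ^ (2 : ℝ)) := by
  rw [deriv_phiLam hp, Real.rpow_two, neg_sq, mul_pow, mul_pow, Real.sq_sqrt hL.le, mul_assoc]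

theorem phiLam_rpow_add (hp : 2 < p) (hL : 0 < Lam) (q s : ℝ) :
    phiLam p Lam s ^ (q + (p - 2)) = p / 2 * Lam *
      (phiLam p Lam s ^ q - phiTanh p Lam s ^ 2 * phiLam p Lam s ^ q) := by
  rw [Real.rpow_add (phiLam_pos hp hL s), phiLam_rpow_sub_two hp hL]
  ring

/-- `∫ φ'² + Λ ∫ φ² = ∫ φ^p`: the equation `-φ'' + Λ φ = φ^(p-1)` tested against `φ`. -/
theorem integral_sq_deriv_phiLam_add (hp : 2 < p) (hL : 0 < Lam) :
    (∫ s, deriv (phiLam p Lam) s ^ 2) + Lam * ∫ s, phiLam p Lam s ^ 2 =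
      ∫ s, phiLam p Lam s ^ p := by
  have hv := integral_phiLam_rpow_virial hp hL two_pos
  have hi := integrable_phiLam_rpow hp hL two_pos
  have hj := integrable_phiTanh_sq_mul hp hL two_pos
  have h1 : ∫ s, phiLam p Lam s ^ p = p / 2 * Lam * ((∫ s, phiLam p Lam s ^ (2 : ℝ)) -
      ∫ s, phiTanh p Lam s ^ 2 * phiLam p Lam s ^ (2 : ℝ)) := by
    rw [← integral_sub hi hj, ← integral_const_mul]
    refine integral_congr_ae (Filter.Eventually.of_forall fun s => ?_)
    simpa using phiLam_rpow_add hp hL 2 s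
  simp only [sq_deriv_phiLam hp hL, ← Real.rpow_two (phiLam p Lam _)]
  rw [integral_const_mul, h1]
  linear_combination -Lam * hv

theorem sq_phiLam_rpow_half (hp : 2 < p) (hL : 0 < Lam) (s : ℝ) :
    (phiLam p Lam s ^ (p / 2)) ^ 2 = phiLam p Lam s ^ p := by
  rw [← Real.rpow_two, ← Real.rpow_mul (phiLam_pos hp hL s).le, div_mul_cancel₀ _ two_ne_zero]

theorem sq_deriv_phiLam_rpow_half (hp : 2 < p) (hL : 0 < Lam) (s : ℝ) :
    deriv (fun s => phiLam p Lam s ^ (p / 2)) s ^ 2 =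
      p ^ 2 / 4 * Lam * (phiTanh p Lam s ^ 2 * phiLam p Lam s ^ p) := by
  rw [(hasDerivAt_phiLam_rpow hp hL _ s).deriv, ← sq_phiLam_rpow_half hp hL, neg_sq, mul_pow,
    mul_pow, mul_pow, Real.sq_sqrt hL.le]
  ring

/-- The function `φ^(p/2)` is an eigenfunction, for the eigenvalue `-Λ (p² - 4) / 4`, of the
linearized operator `-∂² + Λ - (p - 1) φ^(p-2)`: the identity of quadratic forms. -/
theorem integral_sq_deriv_phiLam_rpow_add (hp : 2 < p) (hL : 0 < Lam) :
    (∫ s, deriv (fun s => phiLam p Lam s ^ (p / 2)) s ^ 2) +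
        Lam * (∫ s, (phiLam p Lam s ^ (p / 2)) ^ 2) -
        (p - 1) * ∫ s, phiLam p Lam s ^ (p + (p - 2)) =
      -(Lam * (p ^ 2 - 4) / 4) * ∫ s, (phiLam p Lam s ^ (p / 2)) ^ 2 := by
  have hp0 : 0 < p := by linarith
  have hv := integral_phiLam_rpow_virial hp hL hp0
  have hi := integrable_phiLam_rpow hp hL hp0
  have hj := integrable_phiTanh_sq_mul hp hL hp0
  simp only [sq_phiLam_rpow_half hp hL, sq_deriv_phiLam_rpow_half hp hL, phiLam_rpow_add hp hL]
  rw [integral_const_mul, integral_const_mul, integral_sub hi hj]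
  linear_combination (-Lam * (p / 2)) * hv

theorem integral_phiLam_rpow_pos (hp : 2 < p) (hL : 0 < Lam) {q : ℝ} (hq : 0 < q) :
    0 < ∫ s, phiLam p Lam s ^ q := by
  have hpos : ∀ s, 0 < phiLam p Lam s ^ q := fun s => Real.rpow_pos_of_pos (phiLam_pos hp hL s) _
  rw [integral_pos_iff_support_of_nonneg (fun s => (hpos s).le) (integrable_phiLam_rpow hp hL hq)]
  have : Function.support (fun s => phiLam p Lam s ^ q) = univ :=
    eq_univ_of_forall fun s => (hpos s).ne'
  rw [this]
  simp

theorem integrable_sq_phiLam (hp : 2 < p) (hL : 0 < Lam) :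
    Integrable fun s => phiLam p Lam s ^ 2 := by
  simpa using integrable_phiLam_rpow hp hL two_pos

theorem integrable_sq_deriv_phiLam (hp : 2 < p) (hL : 0 < Lam) :
    Integrable fun s => deriv (phiLam p Lam) s ^ 2 := by
  simp only [sq_deriv_phiLam hp hL]
  exact (integrable_phiTanh_sq_mul hp hL two_pos).const_mul _

theorem integrable_sq_phiLam_rpow_half (hp : 2 < p) (hL : 0 < Lam) :
    Integrable fun s => (phiLam p Lam s ^ (p / 2)) ^ 2 := by
  simp only [sq_phiLam_rpow_half hp hL]
  exact integrable_phiLam_rpow hp hL (by linarith)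

theorem integrable_phiLam_mul_rpow_half (hp : 2 < p) (hL : 0 < Lam) :
    Integrable fun s => phiLam p Lam s * phiLam p Lam s ^ (p / 2) := by
  refine (integrable_phiLam_rpow hp hL (q := 1 + p / 2) (by linarith)).congr
    (Filter.Eventually.of_forall fun s => ?_)
  simp only
  rw [Real.rpow_add (phiLam_pos hp hL s), Real.rpow_one]

theorem integrable_sq_deriv_phiLam_rpow_half (hp : 2 < p) (hL : 0 < Lam) :
    Integrable fun s => deriv (fun s => phiLam p Lam s ^ (p / 2)) s ^ 2 := by
  simp only [sq_deriv_phiLam_rpow_half hp hL]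
  exact (integrable_phiTanh_sq_mul hp hL (by linarith)).const_mul _

theorem integrable_deriv_phiLam_mul_deriv_rpow_half (hp : 2 < p) (hL : 0 < Lam) :
    Integrable fun s =>
      deriv (phiLam p Lam) s * deriv (fun s => phiLam p Lam s ^ (p / 2)) s := by
  refine ((integrable_phiTanh_sq_mul hp hL (q := 1 + p / 2) (by linarith)).const_mul
    (p / 2 * Lam)).congr (Filter.Eventually.of_forall fun s => ?_)
  simp only
  rw [deriv_phiLam hp, (hasDerivAt_phiLam_rpow hp hL _ s).deriv,
    Real.rpow_add (phiLam_pos hp hL s), Real.rpow_one]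
  linear_combination (-(p / 2) * phiTanh p Lam s ^ 2 * phiLam p Lam s *
    phiLam p Lam s ^ (p / 2)) * Real.mul_self_sqrt hL.le

theorem deriv_const_mul_phiLam_rpow (hp : 2 < p) (hL : 0 < Lam) (ε s : ℝ) :
    deriv (fun s => ε * phiLam p Lam s ^ (p / 2)) s =
      ε * deriv (fun s => phiLam p Lam s ^ (p / 2)) s :=
  deriv_const_mul _ (hasDerivAt_phiLam_rpow hp hL _ s).differentiableAt

end Profile

/-! ### Functions on the cylinder -/

section Product

theorem integrable_sq_add_mul {X : Type*} [MeasurableSpace X] {μ : Measure X} [IsFiniteMeasure μ]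
    {a b : ℝ → ℝ} {f : X → ℝ} (haa : Integrable fun s => a s ^ 2)
    (hab : Integrable fun s => a s * b s) (hbb : Integrable fun s => b s ^ 2)
    (hf : Integrable f μ) (hff : Integrable (fun x => f x ^ 2) μ) :
    Integrable (fun q : ℝ × X => (a q.1 + b q.1 * f q.2) ^ 2) ((volume : Measure ℝ).prod μ) := by
  refine (((haa.mul_prod (integrable_const (1 : ℝ))).add
    ((hab.mul_prod hf).const_mul 2)).add (hbb.mul_prod hff)).congr
    (Filter.Eventually.of_forall fun q => ?_)
  simp only [Pi.add_apply]
  ring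

theorem integral_sq_add_mul {X : Type*} [MeasurableSpace X] {μ : Measure X} [IsFiniteMeasure μ]
    {a b : ℝ → ℝ} {f : X → ℝ} (haa : Integrable fun s => a s ^ 2)
    (hab : Integrable fun s => a s * b s) (hbb : Integrable fun s => b s ^ 2)
    (hf : Integrable f μ) (hff : Integrable (fun x => f x ^ 2) μ) (h0 : ∫ x, f x ∂μ = 0) :
    ∫ q : ℝ × X, (a q.1 + b q.1 * f q.2) ^ 2 ∂((volume : Measure ℝ).prod μ) =
      μ.real univ * (∫ s, a s ^ 2) + (∫ s, b s ^ 2) * ∫ x, f x ^ 2 ∂μ := by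
  have h1 := haa.mul_prod (integrable_const (1 : ℝ) (μ := μ))
  have h2 := (hab.mul_prod hf).const_mul 2
  have h3 := hbb.mul_prod hff
  have e : (fun q : ℝ × X => (a q.1 + b q.1 * f q.2) ^ 2) = fun q =>
      (a q.1 ^ 2 * 1 + 2 * (a q.1 * b q.1 * f q.2)) + b q.1 ^ 2 * f q.2 ^ 2 := by
    ext q; ring
  rw [e, integral_add (by exact h1.add h2) h3, integral_add h1 h2, integral_const_mul,
    integral_prod_mul (fun s => a s ^ 2) (fun _ => (1 : ℝ)),
    integral_prod_mul (fun s => a s * b s) f,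
    integral_prod_mul (fun s => b s ^ 2) (fun x => f x ^ 2), h0]
  simp [mul_comm]

end Product

section RealInequalities

/-- A second order Taylor lower bound: any loss in the quadratic coefficient absorbs the
remainder near `0`. -/
theorem eventually_one_add_mul_add_sq_le_rpow {p c : ℝ} (hp : 2 < p) (hc : c < p * (p - 1) / 2) :
    ∀ᶠ t in nhds (0 : ℝ), 1 + p * t + c * t ^ 2 ≤ (1 + t) ^ p := by
  set g : ℝ → ℝ := fun t => (1 + t) ^ p - p * t - c * t ^ 2 with hg
  have hd : ∀ t, HasDerivAt g (p * (1 + t) ^ (p - 1) - p - c * (2 * t)) t := fun t => by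
    have h1 : HasDerivAt (fun t : ℝ => 1 + t) 1 t := (hasDerivAt_id t).const_add 1
    refine (((h1.rpow_const (p := p) (Or.inr (by linarith))).sub
      ((hasDerivAt_id t).const_mul p)).sub (((hasDerivAt_id t).pow 2).const_mul c)).congr_deriv ?_
    simp
  have hd1 : deriv g = fun t => p * (1 + t) ^ (p - 1) - p - c * (2 * t) :=
    funext fun t => (hd t).deriv
  have hd2 : HasDerivAt (deriv g) (p * (p - 1) - 2 * c) 0 := by
    rw [hd1]
    have h1 : HasDerivAt (fun t : ℝ => 1 + t) 1 0 := (hasDerivAt_id 0).const_add 1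
    refine ((((h1.rpow_const (p := p - 1) (Or.inr (by linarith))).const_mul p).sub_const p).sub
      (((hasDerivAt_id (0 : ℝ)).const_mul 2).const_mul c)).congr_deriv ?_
    simp [mul_comm]
  have hmin : IsLocalMin g 0 := by
    refine isLocalMin_of_deriv_deriv_pos ?_ ?_ (hd 0).continuousAt
    · rw [hd2.deriv]; linarith
    · rw [hd1]; simp
  filter_upwards [hmin] with t ht
  simp only [hg, add_zero, Real.one_rpow, mul_zero, sub_zero, ne_eq, OfNat.ofNat_ne_zero,
    not_false_eq_true, zero_pow] at ht
  linarith

theorem eventually_one_add_mul_lt_rpow {r k E : ℝ} (h : E < r * k) :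
    ∀ᶠ x in nhdsWithin (0 : ℝ) (Ioi 0), 1 + E * x < (1 + k * x) ^ r := by
  set g : ℝ → ℝ := fun x => (1 + k * x) ^ r - 1 - E * x with hg
  have hd : HasDerivAt g (r * k - E) 0 := by
    have h1 : HasDerivAt (fun x : ℝ => 1 + k * x) k 0 := by
      simpa using ((hasDerivAt_id (0 : ℝ)).const_mul k).const_add 1
    refine (((h1.rpow_const (p := r) (Or.inl (by simp))).sub_const 1).sub
      ((hasDerivAt_id (0 : ℝ)).const_mul E)).congr_deriv ?_
    simp [mul_comm]
  have hs := (hasDerivAt_iff_tendsto_slope.1 hd).eventually (lt_mem_nhds (sub_pos.2 h))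
  have hs' := nhdsWithin_mono (0 : ℝ) (fun x (hx : x ∈ Ioi (0 : ℝ)) => ne_of_gt hx) hs
  filter_upwards [hs', self_mem_nhdsWithin] with x hx hx0
  have hg0 : g 0 = 0 := by simp [hg]
  rw [slope_def_field, hg0, sub_zero, sub_zero] at hx
  have := (div_pos_iff_of_pos_right (mem_Ioi.1 hx0)).1 hx
  simp only [hg] at this
  linarith

end RealInequalities

section Cylinder

variable {m : ℕ} {M : Type*} [TopologicalSpace M] [ChartedSpace (EuclideanSpace ℝ (Fin m)) M]
  [RiemannianBundle (fun x : M => TangentSpace (𝓡 m) x)]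

local notation "𝔼" => EuclideanSpace ℝ (Fin m)

theorem riemannianGradient_const_add_mul {f : M → ℝ} {x : M}
    (hf : MDifferentiableAt (𝓡 m) 𝓘(ℝ, ℝ) f x) (c k : ℝ) :
    riemannianGradient (m := m) (fun x => c + k * f x) x = k • riemannianGradient f x := by
  have hd : HasDerivAt (fun t : ℝ => c + k * t) k (f x) := by
    simpa using ((hasDerivAt_id (f x)).const_mul k).const_add c
  have h := hd.hasFDerivAt.hasMFDerivAt.comp x hf.hasMFDerivAt
  refine ext_inner_right ℝ fun v => ?_
  rw [inner_riemannianGradient, real_inner_smul_left, inner_riemannianGradient]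
  refine (congrArg (fun L => L v) h.mfderiv).trans ?_
  exact @mul_comm ℝ _ _ _

variable (m) in
/-- The jet of the function `a(s) + b(s) f(x)` on the cylinder. -/
def separatedJet (a b : ℝ → ℝ) (f : M → ℝ) : Jet m M :=
  classicalJet m fun q : ℝ × M => a q.1 + b q.1 * f q.2

theorem separatedJet_ds {a b : ℝ → ℝ} (ha : Differentiable ℝ a) (hb : Differentiable ℝ b)
    (f : M → ℝ) (q : ℝ × M) :
    (separatedJet m a b f).ds q = deriv a q.1 + deriv b q.1 * f q.2 :=
  ((ha q.1).hasDerivAt.add ((hb q.1).hasDerivAt.mul_const (f q.2))).deriv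

theorem separatedJet_grad (a b : ℝ → ℝ) {f : M → ℝ} (hf : ContMDiff (𝓡 m) 𝓘(ℝ, ℝ) ∞ f)
    (q : ℝ × M) : (separatedJet m a b f).grad q = b q.1 • riemannianGradient f q.2 :=
  riemannianGradient_const_add_mul (f := f) (hf.mdifferentiable (by simp) q.2) (a q.1) (b q.1)

theorem sq_norm_separatedJet_grad (a b : ℝ → ℝ) {f : M → ℝ} (hf : ContMDiff (𝓡 m) 𝓘(ℝ, ℝ) ∞ f)
    (q : ℝ × M) : ‖(separatedJet m a b f).grad q‖ ^ 2 = b q.1 ^ 2 * gradPairing m f f q.2 := by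
  rw [separatedJet_grad a b hf, norm_smul, mul_pow, gradPairing_self, Real.norm_eq_abs, sq_abs]

variable [MeasurableSpace M]

theorem h1Norm_lt_top {w : Jet m M}
    (h1 : Integrable (fun q => w.val q ^ 2) (cylinderMeasure m M))
    (h2 : Integrable (fun q => w.ds q ^ 2) (cylinderMeasure m M))
    (h3 : Integrable (fun q => ‖w.grad q‖ ^ 2) (cylinderMeasure m M)) : h1Norm w < ⊤ := by
  have key : ∀ q, ‖w.val q‖ₑ ^ 2 + ‖w.ds q‖ₑ ^ 2 + ‖w.grad q‖ₑ ^ 2 =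
      ENNReal.ofReal (w.val q ^ 2 + w.ds q ^ 2 + ‖w.grad q‖ ^ 2) := fun q => by
    rw [ENNReal.ofReal_add (by positivity) (by positivity),
      ENNReal.ofReal_add (by positivity) (by positivity), ENNReal.ofReal_pow (norm_nonneg _),
      ofReal_norm, ← sq_abs (w.val q), ← sq_abs (w.ds q), ENNReal.ofReal_pow (abs_nonneg _),
      ENNReal.ofReal_pow (abs_nonneg _), ← Real.enorm_eq_ofReal_abs, ← Real.enorm_eq_ofReal_abs]
  rw [h1Norm]
  simp only [key]
  exact ENNReal.rpow_lt_top_of_nonneg (by norm_num) ((h1.add h2).add h3).lintegral_lt_top.ne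

/-- Homogeneity of the `H¹` norm, for jets given componentwise. -/
theorem h1Norm_eq_enorm_mul {w w' : Jet m M} (c : ℝ) (h1 : ∀ q, w.val q = c * w'.val q)
    (h2 : ∀ q, w.ds q = c * w'.ds q) (h3 : ∀ q, ‖w.grad q‖ₑ = ‖c‖ₑ * ‖w'.grad q‖ₑ) :
    h1Norm w = ‖c‖ₑ * h1Norm w' := by
  have key : ∀ q, ‖w.val q‖ₑ ^ 2 + ‖w.ds q‖ₑ ^ 2 + ‖w.grad q‖ₑ ^ 2 =
      ‖c‖ₑ ^ 2 * (‖w'.val q‖ₑ ^ 2 + ‖w'.ds q‖ₑ ^ 2 + ‖w'.grad q‖ₑ ^ 2) := fun q => by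
    rw [h1, h2, h3, enorm_mul, enorm_mul]
    ring
  rw [h1Norm, h1Norm]
  simp only [key]
  rw [lintegral_const_mul' _ _ (by simp), ENNReal.mul_rpow_of_nonneg _ _ (by norm_num),
    ← ENNReal.rpow_natCast, ← ENNReal.rpow_mul]
  norm_num

variable [IsManifold (𝓡 m) ∞ M] [IsContMDiffRiemannianBundle (𝓡 m) ∞ (EuclideanSpace ℝ (Fin m))
    (fun x : M => TangentSpace (𝓡 m) x)] [BorelSpace M]

variable {a b : ℝ → ℝ} {f : M → ℝ}

theorem memH1_separatedJet (hf : ContMDiff (𝓡 m) 𝓘(ℝ, ℝ) ∞ f)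
    (ha : ContDiff ℝ ∞ a) (hb : ContDiff ℝ ∞ b)
    (hfin : h1Norm (separatedJet m a b f) < ⊤) : MemH1 (separatedJet m a b f) where
  aemeasurable_val := by
    have hc : Continuous (separatedJet m a b f).val :=
      (ha.continuous.comp continuous_fst).add
        ((hb.continuous.comp continuous_fst).mul (hf.continuous.comp continuous_snd))
    exact hc.measurable.aemeasurable
  aemeasurable_ds := by
    have hc : Continuous (separatedJet m a b f).ds := by
      have h : (separatedJet m a b f).ds = fun q => deriv a q.1 + deriv b q.1 * f q.2 := funext
        (separatedJet_ds (ha.differentiable (by simp)) (hb.differentiable (by simp)) f)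
      rw [h]
      exact ((ha.continuous_deriv (by simp)).comp continuous_fst).add
        (((hb.continuous_deriv (by simp)).comp continuous_fst).mul
          (hf.continuous.comp continuous_snd))
    exact hc.measurable.aemeasurable
  aemeasurable_grad h hh := by
    have hc : Continuous fun q : ℝ × M => b q.1 * gradPairing m f h q.2 :=
      (hb.continuous.comp continuous_fst).mul
        ((continuous_gradPairing hf hh).comp continuous_snd)
    refine hc.measurable.aemeasurable.congr (Filter.Eventually.of_forall fun q => ?_)
    refine Eq.trans ?_ (congrArg (mfderiv (𝓡 m) 𝓘(ℝ, ℝ) h q.2)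
      (separatedJet_grad a b hf q)).symm
    exact (map_smul (mfderiv (𝓡 m) 𝓘(ℝ, ℝ) h q.2) _ _).symm
  approx ε hε := by
    refine ⟨fun q => a q.1 + b q.1 * f q.2, ?_, hfin, ?_⟩
    · exact (ha.contMDiff.comp contMDiff_fst).add
        ((hb.contMDiff.comp contMDiff_fst).mul (hf.comp contMDiff_snd))
    · have h0 := h1Norm_eq_enorm_mul (w := (separatedJet m a b f).sub (separatedJet m a b f))
        (w' := separatedJet m a b f) 0 (fun q => by simp [Jet.sub]) (fun q => by simp [Jet.sub])
        (fun q => by simp [Jet.sub])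
      rw [enorm_zero, zero_mul] at h0
      exact h0.trans_lt hε

variable [CompactSpace M]

theorem integrable_riemannianVolume (hf : Continuous f) :
    Integrable f (riemannianVolume m M) :=
  hf.integrable_of_hasCompactSupport (HasCompactSupport.of_compactSpace _)

theorem h1Norm_separatedJet_lt_top (hf : ContMDiff (𝓡 m) 𝓘(ℝ, ℝ) ∞ f)
    (ha : ContDiff ℝ ∞ a) (hb : ContDiff ℝ ∞ b)
    (haa : Integrable fun s => a s ^ 2) (hab : Integrable fun s => a s * b s)
    (hbb : Integrable fun s => b s ^ 2) (haa' : Integrable fun s => deriv a s ^ 2)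
    (hab' : Integrable fun s => deriv a s * deriv b s)
    (hbb' : Integrable fun s => deriv b s ^ 2) : h1Norm (separatedJet m a b f) < ⊤ := by
  have h1 := integrable_riemannianVolume (m := m) hf.continuous
  have h2 := integrable_riemannianVolume (m := m) (hf.continuous.pow 2)
  refine h1Norm_lt_top (integrable_sq_add_mul haa hab hbb h1 h2) ?_ ?_
  · simp only [separatedJet_ds (ha.differentiable (by simp)) (hb.differentiable (by simp))]
    exact integrable_sq_add_mul haa' hab' hbb' h1 h2
  · simp only [sq_norm_separatedJet_grad a b hf]
    exact hbb.mul_prod (integrable_riemannianVolume (continuous_gradPairing hf hf))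

end Cylinder

/-! ### The second variation -/

section Perturbation

variable {p Lam : ℝ}

/-- A second order lower bound for the `L^p` norm of `φ + ε φ^(p/2) f` when `f` has mean zero. -/
theorem eventually_le_integral_abs_rpow {X : Type*} [TopologicalSpace X] [CompactSpace X]
    [MeasurableSpace X] [BorelSpace X] {μ : Measure X} [IsFiniteMeasure μ]
    (hp : 2 < p) (hL : 0 < Lam) {f : X → ℝ} (hf : Continuous f) (h0 : ∫ x, f x ∂μ = 0)
    {c : ℝ} (hc : c < p * (p - 1) / 2) :
    ∀ᶠ ε in nhdsWithin (0 : ℝ) (Ioi 0),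
      μ.real univ * (∫ s, phiLam p Lam s ^ p) +
        c * ε ^ 2 * ((∫ s, phiLam p Lam s ^ (p + (p - 2))) * ∫ x, f x ^ 2 ∂μ) ≤
      ∫ q : ℝ × X, |phiLam p Lam q.1 + ε * phiLam p Lam q.1 ^ (p / 2) * f q.2| ^ p
        ∂((volume : Measure ℝ).prod μ) := by
  have hpos := phiLam_pos hp hL
  have hp0 : 0 < p := by linarith
  obtain ⟨τ, hτ, hball⟩ := Metric.eventually_nhds_iff.1
    ((eventually_one_add_mul_add_sq_le_rpow hp hc).and
      (Metric.ball_mem_nhds (0 : ℝ) one_pos))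
  obtain ⟨C, hC⟩ := isCompact_univ.exists_bound_of_continuousOn hf.continuousOn
  set W : ℝ := ((p / 2 * Lam) ^ (1 / (p - 2))) ^ (p / 2 - 1) * |C| + 1 with hW
  have hW0 : 0 < W := by positivity
  have hbound : ∀ q : ℝ × X, |phiLam p Lam q.1 ^ (p / 2 - 1) * f q.2| ≤ W := fun q => by
    rw [abs_mul, abs_of_pos (Real.rpow_pos_of_pos (hpos _) _)]
    refine (mul_le_mul (Real.rpow_le_rpow (hpos _).le (phiLam_le hp hL _) (by linarith))
      ((hC q.2 (mem_univ _)).trans (le_abs_self C)) (abs_nonneg _) (by positivity)).trans ?_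
    linarith
  have hmem : Ioo (0 : ℝ) (τ / W) ∈ nhdsWithin (0 : ℝ) (Ioi 0) := Ioo_mem_nhdsGT (by positivity)
  filter_upwards [hmem] with ε hε
  -- The perturbed function is `φ (1 + t)` with `t` uniformly small.
  set t : ℝ × X → ℝ := fun q => ε * (phiLam p Lam q.1 ^ (p / 2 - 1) * f q.2) with ht
  have htτ : ∀ q, |t q| < τ := fun q => by
    rw [ht, abs_mul, abs_of_pos hε.1]
    calc ε * _ ≤ ε * W := mul_le_mul_of_nonneg_left (hbound q) hε.1.le
      _ < τ := (lt_div_iff₀ hW0).1 hε.2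
  have htq : ∀ q, 1 + p * t q + c * t q ^ 2 ≤ (1 + t q) ^ p ∧ |t q| < 1 := fun q => by
    have h := hball (y := t q) (by simpa [Real.dist_eq] using htτ q)
    exact ⟨h.1, by simpa [Real.dist_eq] using h.2⟩
  have hfac : ∀ q : ℝ × X, |phiLam p Lam q.1 + ε * phiLam p Lam q.1 ^ (p / 2) * f q.2| ^ p =
      phiLam p Lam q.1 ^ p * (1 + t q) ^ p := fun q => by
    have h1 : 0 < 1 + t q := by linarith [(abs_lt.1 (htq q).2).1]
    have h2 : phiLam p Lam q.1 + ε * phiLam p Lam q.1 ^ (p / 2) * f q.2 =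
        phiLam p Lam q.1 * (1 + t q) := by
      have : phiLam p Lam q.1 ^ (p / 2) = phiLam p Lam q.1 * phiLam p Lam q.1 ^ (p / 2 - 1) := by
        rw [Real.rpow_sub_one (hpos _).ne', mul_div_cancel₀ _ (hpos _).ne']
      rw [this, ht]
      ring
    rw [h2, abs_of_pos (mul_pos (hpos _) h1), Real.mul_rpow (hpos _).le h1.le]
  have hfi : Integrable f μ :=
    hf.integrable_of_hasCompactSupport (HasCompactSupport.of_compactSpace _)
  have hffi : Integrable (fun x => f x ^ 2) μ :=
    (hf.pow 2).integrable_of_hasCompactSupport (HasCompactSupport.of_compactSpace _)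
  have i0 := (integrable_phiLam_rpow hp hL hp0).mul_prod (integrable_const (1 : ℝ) (μ := μ))
  have i1 := ((integrable_phiLam_rpow hp hL (q := p + (p / 2 - 1)) (by linarith)).mul_prod
    hfi).const_mul (p * ε)
  have i2 := ((integrable_phiLam_rpow hp hL (q := p + (p - 2)) (by linarith)).mul_prod
    hffi).const_mul (c * ε ^ 2)
  have hlow : ∀ q : ℝ × X, phiLam p Lam q.1 ^ p * 1 +
      p * ε * (phiLam p Lam q.1 ^ (p + (p / 2 - 1)) * f q.2) +
      c * ε ^ 2 * (phiLam p Lam q.1 ^ (p + (p - 2)) * f q.2 ^ 2) ≤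
      |phiLam p Lam q.1 + ε * phiLam p Lam q.1 ^ (p / 2) * f q.2| ^ p := fun q => by
    rw [hfac, Real.rpow_add (hpos _), Real.rpow_add (hpos _)]
    have hsq : phiLam p Lam q.1 ^ (p - 2) = (phiLam p Lam q.1 ^ (p / 2 - 1)) ^ 2 := by
      rw [← Real.rpow_two, ← Real.rpow_mul (hpos _).le]
      ring_nf
    refine le_trans (le_of_eq ?_) (mul_le_mul_of_nonneg_left (htq q).1
      (Real.rpow_nonneg (hpos q.1).le p))
    rw [hsq, ht]
    ring
  have hup : Integrable (fun q : ℝ × X =>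
      |phiLam p Lam q.1 + ε * phiLam p Lam q.1 ^ (p / 2) * f q.2| ^ p)
      ((volume : Measure ℝ).prod μ) := by
    have hcont : Continuous fun q : ℝ × X =>
        |phiLam p Lam q.1 + ε * phiLam p Lam q.1 ^ (p / 2) * f q.2| ^ p := by
      refine Continuous.rpow_const (Continuous.abs ?_) fun _ => Or.inr hp0.le
      exact (contDiff_phiLam.continuous.comp continuous_fst).add ((continuous_const.mul
        ((contDiff_phiLam_rpow hp hL (p / 2)).continuous.comp continuous_fst)).mul
        (hf.comp continuous_snd))
    refine ((integrable_phiLam_rpow hp hL hp0).mul_prod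
      (integrable_const ((2 : ℝ) ^ p) (μ := μ))).mono' hcont.measurable.aestronglyMeasurable
      (Filter.Eventually.of_forall fun q => ?_)
    have h1 : 0 < 1 + t q := by linarith [(abs_lt.1 (htq q).2).1]
    rw [Real.norm_of_nonneg (by positivity), hfac]
    exact mul_le_mul_of_nonneg_left (Real.rpow_le_rpow h1.le
      (by linarith [(abs_lt.1 (htq q).2).2]) hp0.le) (Real.rpow_nonneg (hpos q.1).le p)
  refine le_trans (le_of_eq ?_) (integral_mono ((i0.add i1).add i2) hup hlow)
  simp only [Pi.add_apply]
  rw [integral_add (by exact i0.add i1) i2, integral_add i0 i1, integral_const_mul,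
    integral_const_mul, integral_prod_mul (fun s => phiLam p Lam s ^ p) (fun _ => (1 : ℝ)),
    integral_prod_mul (fun s => phiLam p Lam s ^ (p + (p / 2 - 1))) f,
    integral_prod_mul (fun s => phiLam p Lam s ^ (p + (p - 2))) (fun x => f x ^ 2), h0]
  simp [mul_comm]

end Perturbation

section Minimizer

variable {m : ℕ} {M : Type*} [TopologicalSpace M] [ChartedSpace (EuclideanSpace ℝ (Fin m)) M]
  [RiemannianBundle (fun x : M => TangentSpace (𝓡 m) x)]

variable (m) in
/-- The jet of the perturbation `φ + ε φ^(p/2) f` of the symmetric function. -/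
def perturbedJet (p Lam : ℝ) (f : M → ℝ) (ε : ℝ) : Jet m M :=
  separatedJet m (phiLam p Lam) (fun s => ε * phiLam p Lam s ^ (p / 2)) f

theorem perturbedJet_zero (p Lam : ℝ) (f : M → ℝ) :
    perturbedJet m p Lam f 0 = symmetricJet m M p Lam := by
  simp [perturbedJet, separatedJet, symmetricJet]

variable {p Lam : ℝ} {f : M → ℝ} [MeasurableSpace M]

/-- The constant `μ⋆` is normalized so that `μ⋆ ‖φ‖_p² = vol(M) ∫ φ^p`. -/
theorem muStar_mul_rpow (hp : 2 < p) (hL : 0 < Lam) {x : ℝ} (hx : 0 ≤ x)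
    (hV : 0 < (riemannianVolume m M).real univ) :
    muStar m M p Lam *
        ((riemannianVolume m M).real univ * (∫ s, phiLam p Lam s ^ p) * x) ^ (2 / p) =
      (riemannianVolume m M).real univ * (∫ s, phiLam p Lam s ^ p) * x ^ (2 / p) := by
  have hB := integral_phiLam_rpow_pos hp hL (q := p) (by linarith)
  have habs : ∀ s, |phiLam p Lam s| = phiLam p Lam s := fun s => abs_of_pos (phiLam_pos hp hL s)
  rw [muStar, muLine, integral_sq_deriv_phiLam_add hp hL]
  simp only [habs]
  rw [Real.mul_rpow (by positivity) hx, Real.mul_rpow hV.le hB.le, Real.rpow_sub hV, Real.rpow_one]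
  have h1 := Real.rpow_pos_of_pos hV (2 / p)
  have h2 := Real.rpow_pos_of_pos hB (2 / p)
  field_simp

theorem muStar_nonneg (hp : 2 < p) (hL : 0 < Lam) : 0 ≤ muStar m M p Lam := by
  have hB := integral_phiLam_rpow_pos hp hL (q := p) (by linarith)
  rw [muStar, muLine, integral_sq_deriv_phiLam_add hp hL]
  refine mul_nonneg (Real.rpow_nonneg measureReal_nonneg _)
    (div_nonneg hB.le (Real.rpow_nonneg ?_ _))
  exact integral_nonneg fun s => Real.rpow_nonneg (abs_nonneg _) _

variable [IsManifold (𝓡 m) ∞ M]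
  [IsContMDiffRiemannianBundle (𝓡 m) ∞ (EuclideanSpace ℝ (Fin m))
    (fun x : M => TangentSpace (𝓡 m) x)] [BorelSpace M] [CompactSpace M]

theorem memH1_perturbedJet (hp : 2 < p) (hL : 0 < Lam) (hf : ContMDiff (𝓡 m) 𝓘(ℝ, ℝ) ∞ f)
    (ε : ℝ) : MemH1 (perturbedJet m p Lam f ε) := by
  have hb : ContDiff ℝ ∞ fun s => ε * phiLam p Lam s ^ (p / 2) :=
    contDiff_const.mul (contDiff_phiLam_rpow hp hL _)
  refine memH1_separatedJet hf contDiff_phiLam hb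
    (h1Norm_separatedJet_lt_top hf contDiff_phiLam hb (integrable_sq_phiLam hp hL) ?_ ?_
      (integrable_sq_deriv_phiLam hp hL) ?_ ?_)
  · simpa only [mul_left_comm] using (integrable_phiLam_mul_rpow_half hp hL).const_mul ε
  · simpa only [mul_pow] using (integrable_sq_phiLam_rpow_half hp hL).const_mul (ε ^ 2)
  · simp only [deriv_const_mul_phiLam_rpow hp hL]
    simpa only [mul_left_comm] using
      (integrable_deriv_phiLam_mul_deriv_rpow_half hp hL).const_mul ε
  · simp only [deriv_const_mul_phiLam_rpow hp hL]
    simpa only [mul_pow] using (integrable_sq_deriv_phiLam_rpow_half hp hL).const_mul (ε ^ 2)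

theorem tendsto_h1Norm_perturbedJet_sub (hp : 2 < p) (hL : 0 < Lam)
    (hf : ContMDiff (𝓡 m) 𝓘(ℝ, ℝ) ∞ f) :
    Filter.Tendsto
      (fun ε => h1Norm ((perturbedJet m p Lam f ε).sub (perturbedJet m p Lam f 0)))
      (nhds 0) (nhds 0) := by
  set ψ : ℝ → ℝ := fun s => phiLam p Lam s ^ (p / 2) with hψ
  have hψs : ContDiff ℝ ∞ ψ := contDiff_phiLam_rpow hp hL _
  have hd : ∀ ε, Differentiable ℝ fun s => ε * ψ s := fun ε =>
    (hψs.differentiable (by simp)).const_mul ε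
  have hφ : Differentiable ℝ (phiLam p Lam) := contDiff_phiLam.differentiable (by simp)
  have hfin : h1Norm (separatedJet m (fun _ => 0) ψ f) < ⊤ :=
    h1Norm_separatedJet_lt_top hf contDiff_const hψs (by simp) (by simp)
      (integrable_sq_phiLam_rpow_half hp hL) (by simp) (by simp)
      (integrable_sq_deriv_phiLam_rpow_half hp hL)
  have key : ∀ ε, h1Norm ((perturbedJet m p Lam f ε).sub (perturbedJet m p Lam f 0)) =
      ‖ε‖ₑ * h1Norm (separatedJet m (fun _ => 0) ψ f) := fun ε => by
    refine h1Norm_eq_enorm_mul ε (fun q => ?_) (fun q => ?_) fun q => ?_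
    · simp [Jet.sub, perturbedJet, separatedJet, classicalJet, hψ, mul_assoc]
    · simp only [Jet.sub, perturbedJet]
      rw [separatedJet_ds hφ (hd ε), separatedJet_ds hφ (hd 0),
        separatedJet_ds (differentiable_const 0) (hψs.differentiable (by simp)),
        deriv_const_mul_phiLam_rpow hp hL, deriv_const_mul_phiLam_rpow hp hL, deriv_const]
      ring
    · simp only [Jet.sub, perturbedJet]
      rw [separatedJet_grad _ _ hf, separatedJet_grad _ _ hf, separatedJet_grad _ _ hf, zero_mul,
        zero_smul, sub_zero, mul_smul, enorm_smul]
  simp only [key]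
  have h := ENNReal.Tendsto.mul_const (b := h1Norm (separatedJet m (fun _ => 0) ψ f))
    (continuous_enorm.tendsto (0 : ℝ)) (Or.inr hfin.ne)
  simpa using h

theorem gnFunctional_perturbedJet (hp : 2 < p) (hL : 0 < Lam) {lam : ℝ}
    (hf : ContMDiff (𝓡 m) 𝓘(ℝ, ℝ) ∞ f)
    (h0 : ∫ x, f x ∂(riemannianVolume m M) = 0)
    (h1 : ∫ x, gradPairing m f f x ∂(riemannianVolume m M) =
      lam * ∫ x, f x ^ 2 ∂(riemannianVolume m M)) (ε : ℝ) :
    gnFunctional m M p Lam (perturbedJet m p Lam f ε) =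
      (riemannianVolume m M).real univ * (∫ s, phiLam p Lam s ^ p) +
      ε ^ 2 * ((∫ x, f x ^ 2 ∂(riemannianVolume m M)) *
        ((p - 1) * (∫ s, phiLam p Lam s ^ (p + (p - 2))) +
          (lam - Lam * (p ^ 2 - 4) / 4) * ∫ s, phiLam p Lam s ^ p)) -
      muStar m M p Lam * (∫ q : ℝ × M,
        |phiLam p Lam q.1 + ε * phiLam p Lam q.1 ^ (p / 2) * f q.2| ^ p
          ∂((volume : Measure ℝ).prod (riemannianVolume m M))) ^ (2 / p) := by
  have hφ : Differentiable ℝ (phiLam p Lam) := contDiff_phiLam.differentiable (by simp)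
  have hd : Differentiable ℝ fun s => ε * phiLam p Lam s ^ (p / 2) :=
    ((contDiff_phiLam_rpow hp hL _).differentiable (by simp)).const_mul ε
  have hfi := integrable_riemannianVolume (m := m) hf.continuous
  have hffi := integrable_riemannianVolume (m := m) (hf.continuous.pow 2)
  have hds : ∫ q, (perturbedJet m p Lam f ε).ds q ^ 2 ∂(cylinderMeasure m M) =
      (riemannianVolume m M).real univ * (∫ s, deriv (phiLam p Lam) s ^ 2) +
      ε ^ 2 * (∫ s, deriv (fun s => phiLam p Lam s ^ (p / 2)) s ^ 2) *
        ∫ x, f x ^ 2 ∂(riemannianVolume m M) := by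
    simp only [perturbedJet, separatedJet_ds hφ hd, cylinderMeasure]
    rw [integral_sq_add_mul (integrable_sq_deriv_phiLam hp hL) ?_ ?_ hfi hffi h0]
    · simp only [deriv_const_mul_phiLam_rpow hp hL, mul_pow, integral_const_mul]
    · simp only [deriv_const_mul_phiLam_rpow hp hL]
      simpa only [mul_left_comm] using
        (integrable_deriv_phiLam_mul_deriv_rpow_half hp hL).const_mul ε
    · simp only [deriv_const_mul_phiLam_rpow hp hL]
      simpa only [mul_pow] using (integrable_sq_deriv_phiLam_rpow_half hp hL).const_mul (ε ^ 2)
  have hval : ∫ q, (perturbedJet m p Lam f ε).val q ^ 2 ∂(cylinderMeasure m M) =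
      (riemannianVolume m M).real univ * (∫ s, phiLam p Lam s ^ 2) +
      ε ^ 2 * (∫ s, (phiLam p Lam s ^ (p / 2)) ^ 2) *
        ∫ x, f x ^ 2 ∂(riemannianVolume m M) := by
    simp only [perturbedJet, separatedJet, classicalJet, cylinderMeasure]
    rw [integral_sq_add_mul (b := fun s => ε * phiLam p Lam s ^ (p / 2))
      (integrable_sq_phiLam hp hL) ?_ ?_ hfi hffi h0]
    · simp only [mul_pow, integral_const_mul]
    · simpa only [mul_left_comm] using (integrable_phiLam_mul_rpow_half hp hL).const_mul ε
    · simpa only [mul_pow] using (integrable_sq_phiLam_rpow_half hp hL).const_mul (ε ^ 2)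
  have hgrad : ∫ q, ‖(perturbedJet m p Lam f ε).grad q‖ ^ 2 ∂(cylinderMeasure m M) =
      ε ^ 2 * (∫ s, (phiLam p Lam s ^ (p / 2)) ^ 2) *
        (lam * ∫ x, f x ^ 2 ∂(riemannianVolume m M)) := by
    simp only [perturbedJet, sq_norm_separatedJet_grad _ _ hf, cylinderMeasure]
    rw [integral_prod_mul (fun s => (ε * phiLam p Lam s ^ (p / 2)) ^ 2) (gradPairing m f f), h1]
    simp only [mul_pow, integral_const_mul]
  have hA := integral_sq_deriv_phiLam_add hp hL
  have hB := integral_sq_deriv_phiLam_rpow_add hp hL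
  have hP : (∫ q, |(perturbedJet m p Lam f ε).val q| ^ p ∂(cylinderMeasure m M)) =
    ∫ q : ℝ × M, |phiLam p Lam q.1 + ε * phiLam p Lam q.1 ^ (p / 2) * f q.2| ^ p
          ∂((volume : Measure ℝ).prod (riemannianVolume m M)) := rfl
  rw [gnFunctional, hds, hval, hgrad, hP]
  simp only [sq_phiLam_rpow_half hp hL] at hB ⊢
  linear_combination (riemannianVolume m M).real univ * hA +
    ε ^ 2 * (∫ x, f x ^ 2 ∂(riemannianVolume m M)) * hB

theorem eventually_gnFunctional_perturbedJet_lt (hp : 2 < p) (hL : 0 < Lam) {lam : ℝ}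
    (hf : ContMDiff (𝓡 m) 𝓘(ℝ, ℝ) ∞ f) (hne : f ≠ 0)
    (h0 : ∫ x, f x ∂(riemannianVolume m M) = 0)
    (h1 : ∫ x, gradPairing m f f x ∂(riemannianVolume m M) =
      lam * ∫ x, f x ^ 2 ∂(riemannianVolume m M))
    (hlam : lam < Lam * (p ^ 2 - 4) / 4) :
    ∀ᶠ ε in nhdsWithin (0 : ℝ) (Ioi 0),
      gnFunctional m M p Lam (perturbedJet m p Lam f ε) <
        gnFunctional m M p Lam (perturbedJet m p Lam f 0) := by
  have hp0 : 0 < p := by linarith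
  obtain ⟨x₀, hx₀⟩ := Function.ne_iff.1 hne
  have hV : 0 < (riemannianVolume m M).real univ :=
    ENNReal.toReal_pos (isOpen_univ.measure_pos _ ⟨x₀, mem_univ _⟩).ne' (measure_ne_top _ _)
  have hN : 0 < ∫ x, f x ^ 2 ∂(riemannianVolume m M) :=
    (hf.continuous.pow 2).integral_pos_of_hasCompactSupport_nonneg_nonzero
      (HasCompactSupport.of_compactSpace _) (fun x => sq_nonneg _) (x := x₀)
      (pow_ne_zero 2 hx₀)
  have hB := integral_phiLam_rpow_pos hp hL hp0
  have hC := integral_phiLam_rpow_pos hp hL (q := p + (p - 2)) (by linarith)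
  have hG := gnFunctional_perturbedJet hp hL hf h0 h1
  have hmu := fun {x : ℝ} (hx : 0 ≤ x) => muStar_mul_rpow (m := m) (M := M) hp hL hx hV
  have hmu0 : 0 ≤ muStar m M p Lam := muStar_nonneg hp hL
  have hlow := fun {c : ℝ} (hc : c < p * (p - 1) / 2) =>
    eventually_le_integral_abs_rpow (μ := riemannianVolume m M) hp hL hf.continuous h0 hc
  set V := (riemannianVolume m M).real univ
  set N := ∫ x, f x ^ 2 ∂(riemannianVolume m M)
  set B := ∫ s, phiLam p Lam s ^ p
  set C := ∫ s, phiLam p Lam s ^ (p + (p - 2))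
  -- The functional vanishes at the symmetric function.
  have hG0 : gnFunctional m M p Lam (perturbedJet m p Lam f 0) = 0 := by
    have hint : ∫ q : ℝ × M, |phiLam p Lam q.1 + 0 * phiLam p Lam q.1 ^ (p / 2) * f q.2| ^ p
        ∂((volume : Measure ℝ).prod (riemannianVolume m M)) = V * B * 1 := by
      have : ∀ q : ℝ × M, |phiLam p Lam q.1 + 0 * phiLam p Lam q.1 ^ (p / 2) * f q.2| ^ p =
          phiLam p Lam q.1 ^ p * 1 := fun q => by
        rw [zero_mul, zero_mul, add_zero, abs_of_pos (phiLam_pos hp hL _), mul_one]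
      simp only [this]
      rw [integral_prod_mul (fun s => phiLam p Lam s ^ p) (fun _ => (1 : ℝ))]
      simp [mul_comm, V, B]
    rw [hG, hint, hmu zero_le_one, Real.one_rpow]
    ring
  rw [hG0]
  set D := (p - 1) * C + (lam - Lam * (p ^ 2 - 4) / 4) * B with hD
  have hDC : p / 2 * D / C < p * (p - 1) / 2 := by
    have h : (lam - Lam * (p ^ 2 - 4) / 4) * B < 0 := mul_neg_of_neg_of_pos (by linarith) hB
    have h' : p / 2 * D < p / 2 * ((p - 1) * C) :=
      mul_lt_mul_of_pos_left (by linarith) (by linarith)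
    rw [div_lt_iff₀ hC]
    linarith
  -- Replacing the Taylor coefficient `p (p - 1) / 2` by a smaller `c` absorbs the remainder,
  -- while the strict inequality leaves room for the second variation to stay negative.
  obtain ⟨c, hc1, hc2⟩ := exists_between hDC
  have hE : N * D / (V * B) < 2 / p * (c * (C * N) / (V * B)) := by
    rw [← mul_div_assoc, div_lt_div_iff_of_pos_right (by positivity)]
    rw [div_lt_iff₀ hC] at hc1
    have h2 : N * D = 2 / p * (p / 2 * D * N) := by field_simp
    rw [h2]
    have := mul_lt_mul_of_pos_right hc1 hN
    exact mul_lt_mul_of_pos_left (by linarith) (by positivity)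
  have hsq : Filter.Tendsto (fun ε : ℝ => ε ^ 2) (nhdsWithin 0 (Ioi 0))
      (nhdsWithin 0 (Ioi 0)) := by
    refine tendsto_nhdsWithin_iff.2 ⟨?_, ?_⟩
    · have : Filter.Tendsto (fun ε : ℝ => ε ^ 2) (nhds 0) (nhds (0 ^ 2)) :=
        (continuous_pow 2).tendsto 0
      rw [zero_pow two_ne_zero] at this
      exact this.mono_left nhdsWithin_le_nhds
    · filter_upwards [self_mem_nhdsWithin] with ε hε
      exact pow_pos (mem_Ioi.1 hε) 2
  have hκ : ∀ᶠ x in nhdsWithin (0 : ℝ) (Ioi 0), 0 < 1 + c * (C * N) / (V * B) * x := by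
    have hc : ContinuousAt (fun x : ℝ => 1 + c * (C * N) / (V * B) * x) 0 := by fun_prop
    exact (hc.eventually (lt_mem_nhds (by simp))).filter_mono nhdsWithin_le_nhds
  filter_upwards [hlow hc2, hsq.eventually (eventually_one_add_mul_lt_rpow hE),
    hsq.eventually hκ] with ε hε1 hε2 hε3
  have hrew : V * B + c * ε ^ 2 * (C * N) = V * B * (1 + c * (C * N) / (V * B) * ε ^ 2) := by
    field_simp
  rw [hrew] at hε1
  have h3 := mul_le_mul_of_nonneg_left
    (Real.rpow_le_rpow (by positivity) hε1 (by positivity : 0 ≤ 2 / p)) hmu0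
  rw [hmu hε3.le] at h3
  have h4 := mul_lt_mul_of_pos_left hε2 (mul_pos hV hB)
  have h5 : V * B * (1 + N * D / (V * B) * ε ^ 2) = V * B + ε ^ 2 * (N * D) := by
    field_simp
  rw [hG]
  linarith

end Minimizer

end GNCylinder

end

theorem proposition2p1 (d : ℕ) (hd : 2 ≤ d)
    {M : Type*} [TopologicalSpace M] [T2Space M] [CompactSpace M] [ConnectedSpace M]
    [MeasurableSpace M] [BorelSpace M]
    [ChartedSpace (EuclideanSpace ℝ (Fin (d - 1))) M] [IsManifold (𝓡 (d - 1)) ∞ M]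
    [RiemannianBundle (fun x : M => TangentSpace (𝓡 (d - 1)) x)]
    [IsContMDiffRiemannianBundle (𝓡 (d - 1)) ∞ (EuclideanSpace ℝ (Fin (d - 1)))
      (fun x : M => TangentSpace (𝓡 (d - 1)) x)]
    (p Lam lam1 : ℝ) (hp : 2 < p) (hp' : 3 ≤ d → p < 2 * (d : ℝ) / ((d : ℝ) - 2))
    (hlam1 : GNCylinder.IsFirstPositiveEigenvalue (d - 1) M lam1)
    (hLam : 4 * lam1 / (p ^ 2 - 4) < Lam) :
    GNCylinder.MemH1 (GNCylinder.symmetricJet (d - 1) M p Lam) ∧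
      ¬ GNCylinder.IsLocalMinimizer (GNCylinder.gnFunctional (d - 1) M p Lam)
          (GNCylinder.symmetricJet (d - 1) M p Lam) := by
  obtain ⟨⟨hlam, f, hf, hne, hev⟩, -⟩ := hlam1
  have hp4 : 0 < p ^ 2 - 4 := by nlinarith
  have hL : 0 < Lam := lt_trans (by positivity) hLam
  have hgap : lam1 < Lam * (p ^ 2 - 4) / 4 := by
    rw [div_lt_iff₀ hp4] at hLam
    linarith
  -- Testing the weak equation against `1` and against `f` itself.
  have h0 : ∫ x, f x ∂(GNCylinder.riemannianVolume (d - 1) M) = 0 := by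
    have h := GNCylinder.integral_gradPairing hf hev (contMDiff_const (c := (1 : ℝ)))
    simp only [GNCylinder.gradPairing_const_right, integral_zero, mul_one] at h
    exact (mul_eq_zero.1 h.symm).resolve_left hlam.ne'
  have h1 := GNCylinder.integral_gradPairing hf hev hf
  simp only [← sq] at h1
  rw [← GNCylinder.perturbedJet_zero p Lam f]
  refine ⟨GNCylinder.memH1_perturbedJet hp hL hf 0, ?_⟩
  rintro ⟨-, δ, hδ, hmin⟩
  have hnear : ∀ᶠ ε in nhdsWithin (0 : ℝ) (Ioi 0),
      GNCylinder.h1Norm ((GNCylinder.perturbedJet (d - 1) p Lam f ε).sub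
        (GNCylinder.perturbedJet (d - 1) p Lam f 0)) < δ :=
    ((GNCylinder.tendsto_h1Norm_perturbedJet_sub hp hL hf).eventually (gt_mem_nhds hδ)).filter_mono
      nhdsWithin_le_nhds
  obtain ⟨ε, hε1, hε2⟩ := (hnear.and
    (GNCylinder.eventually_gnFunctional_perturbedJet_lt hp hL hf hne h0 h1 hgap)).exists
  exact absurd (hmin _ (GNCylinder.memH1_perturbedJet hp hL hf ε) hε1) (not_le.2 hε2)
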